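/- Let $K$ be a field of characteristic $0$. For $m\geq 1$ let $\mathfrak{so}_{2m}=\mathfrak{so}_{2m}(K)$ be the split orthogonal Lie algebra of all $X\in\mathfrak{gl}_{2m}(K)$ that are skew-adjoint for the symmetric bilinear form on $V=K^{2m}$ with basis $e_1,\dots,e_m,e_{-1},\dots,e_{-m}$ given by $(e_i,e_{-i})=(e_{-i},e_i)=1$ and all other pairings zero. Let $\mathbf{U}_1(\mathfrak{so}_{2m})$ be its universal enveloping algebra, acting on $V$ (the vector representation) and, through the usual coproduct, on $V^{\otimes d}$. Let $\tau\in\mathrm{GL}(V)$ be the reflection that exchanges $e_m$ and $e_{-m}$ and fixes the other basis vectors, and let $\sigma$ be the involution of $\mathbf{U}_1(\mathfrak{so}_{2m})$ induced by $X\mapsto \tau X\tau^{-1}$. (For $m\geq 2$ this is the automorphism induced by the symmetry of the Dynkin diagram of type $D_m$ that exchanges $\alpha_{m-1}=\varepsilon_{m-1}-\varepsilon_m$ and $\alpha_m=\varepsilon_{m-1}+\varepsilon_m$; for $m=1$ it is $X\mapsto -X$ on the one-dimensional Lie algebra $\mathfrak{so}_2$.) Let $\tilde{\mathbf{U}}_1=\mathbf{U}_1(\mathfrak{so}_{2m})\rtimes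 K(\mathbb{Z}/2\mathbb{Z})$ be the skew group ring, whose elements are $x+y\tau$ with $x,y\in\mathbf{U}_1(\mathfrak{so}_{2m})$ and in which $\tau^2=1$ and $\tau x=\sigma(x)\tau$; it acts on $V^{\otimes d}$, with $\tau$ acting as $\tau\otimes\cdots\otimes\tau$. Let $d,m,m'$ be integers with $1\leq d\leq 2m<m'$, and let $V'=K^{2m'}$ be the vector representation of $\mathbf{U}_1(\mathfrak{so}_{2m'})$. Then $$\dim_K \mathrm{End}_{\tilde{\mathbf{U}}_1}\bigl(V^{\otimes d}\bigr)=\dim_K\mathrm{End}_{\mathbf{U}_1(\mathfrak{so}_{2m'})}\bigl((V')^{\otimes d}\bigr).$$ -/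

import Mathlib

open scoped TensorProduct

namespace SchurWeylD

noncomputable section

attribute [local instance 100] LieRing.ofAssociativeRing

/-- The endomorphism algebra `End_A(M)` of a module `M` over a `K`-algebra `A`, the module structure
being given by `ρ : A → End_K(M)`: all `K`-linear `f` with `f (a m) = a (f m)`. -/
def EndAlg {K A M : Type*} [Field K] [Ring A] [Algebra K A] [AddCommGroup M] [Module K M]
    (ρ : A →ₐ[K] Module.End K M) : Subalgebra K (Module.End K M) where
  carrier := {f | ∀ (a : A) (v : M), f (ρ a v) = ρ a (f v)}
  mul_mem' hf hg a v := by
    simp only [Set.mem_ofPred_eq] at hf hg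
    simp only [Module.End.mul_apply, hg, hf]
  add_mem' hf hg a v := by
    simp only [Set.mem_ofPred_eq] at hf hg
    simp only [LinearMap.add_apply, hf, hg, map_add]
  algebraMap_mem' r a v := by
    simp [Module.algebraMap_end_apply]

/-! ### The cyclic group of order two -/

/-- The group `ℤ/2ℤ`, written multiplicatively. -/
abbrev C2 : Type := Multiplicative (ZMod 2)

/-- The homomorphism from `ℤ/2ℤ` sending the generator to a given element of square one. -/
def involutionHom {G : Type*} [Monoid G] (g : G) (hg : g * g = 1) : C2 →* G where
  toFun z := g ^ (Multiplicative.toAdd z).val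
  map_one' := by simp
  map_mul' x y := by
    have key : ∀ a b : ZMod 2, g ^ (a + b).val = g ^ a.val * g ^ b.val := by
      intro a b
      fin_cases a <;> fin_cases b
      · change g ^ 0 = g ^ 0 * g ^ 0; simp
      · change g ^ 1 = g ^ 0 * g ^ 1; simp
      · change g ^ 1 = g ^ 1 * g ^ 0; simp
      · change g ^ 0 = g ^ 1 * g ^ 1; simp [hg]
    exact key x.toAdd y.toAdd

/-! ### Tensor powers -/

section Tensor

variable {K V : Type*} [Field K] [AddCommGroup V] [Module K V]

/-- The action of a Lie algebra element on `V^{⊗d}` induced by its action `A` on `V`: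
`∑ i, 1 ⊗ ⋯ ⊗ A ⊗ ⋯ ⊗ 1` with `A` in position `i`. -/
def leibniz (d : ℕ) : Module.End K V →ₗ⁅K⁆ Module.End K (⨂[K] _ : Fin d, V) where
  toFun A := ∑ i : Fin d, PiTensorProduct.map (Function.update (fun _ => LinearMap.id) i A)
  map_add' A B := by
    simp only [PiTensorProduct.map_update_add, Finset.sum_add_distrib]
  map_smul' c A := by
    simp only [PiTensorProduct.map_update_smul, Finset.smul_sum, RingHom.id_apply]
  map_lie' {A B} := by
    set F : Fin d → Module.End K V → Module.End K (⨂[K] _ : Fin d, V) :=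
      fun i A => PiTensorProduct.map (Function.update (fun _ => LinearMap.id) i A) with hF
    have hF' : ∀ i A, F i A = PiTensorProduct.mapMonoidHom (Pi.mulSingle i A) := fun i A => rfl
    have hmul : ∀ i A B, F i (A * B) = F i A * F i B := fun i A B => by
      rw [hF', Pi.mulSingle_mul, map_mul]; rfl
    have hcomm : ∀ i j A B, i ≠ j → F i A * F j B = F j B * F i A := fun i j A B hij => by
      rw [hF', hF', ← map_mul, ← map_mul]
      congr 1
      exact Pi.mulSingle_commute (f := fun _ : Fin d => Module.End K V) hij A B
    have hsub : ∀ i A B, F i (A - B) = F i A - F i B := fun i A B => by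
      have h1 : F i (A - B + B) = F i (A - B) + F i B := PiTensorProduct.map_update_add _ _ _ _
      rw [sub_add_cancel] at h1
      rw [h1, add_sub_cancel_right]
    change ∑ i, F i ⁅A, B⁆ = ⁅∑ i, F i A, ∑ j, F j B⁆
    simp only [LieRing.of_associative_ring_bracket, hsub, hmul, Finset.sum_mul_sum]
    rw [Finset.sum_comm (f := fun i j => F i B * F j A), ← Finset.sum_sub_distrib]
    refine Finset.sum_congr rfl fun i _ => ?_
    rw [← Finset.sum_sub_distrib, Finset.sum_eq_single i]
    · intro j _ hj
      rw [hcomm i j A B hj.symm, sub_self]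
    · simp

/-- A linear map acting diagonally on `V^{⊗d}`, as `g ⊗ ⋯ ⊗ g`. -/
def diagonal (d : ℕ) (g : Module.End K V) : Module.End K (⨂[K] _ : Fin d, V) :=
  PiTensorProduct.map fun _ => g

theorem diagonal_mul_self (d : ℕ) {g : Module.End K V} (hg : g * g = 1) :
    diagonal d g * diagonal d g = 1 := by
  rw [diagonal, ← PiTensorProduct.map_mul]
  simp only [hg]
  exact PiTensorProduct.map_one

theorem leibniz_mul_diagonal (d : ℕ) {g A B : Module.End K V} (h : B * g = g * A) :
    leibniz d B * diagonal d g = diagonal d g * leibniz d A := by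
  change (∑ i : Fin d, _) * _ = _ * (∑ i : Fin d, _)
  rw [Finset.sum_mul, Finset.mul_sum]
  refine Finset.sum_congr rfl fun i _ => ?_
  rw [diagonal, ← PiTensorProduct.map_mul, ← PiTensorProduct.map_mul]
  congr 1
  funext j
  by_cases hj : j = i
  · subst hj; simpa using h
  · simp only [Function.update_of_ne hj]
    rfl

end Tensor

/-! ### The orthogonal Lie algebra of type `D_m`, its diagram automorphism and the algebras -/

variable (K : Type*) [Field K] (m : ℕ)

/-- The split even orthogonal Lie algebra `so_{2m}` over `K`: matrices that are skew-adjoint for the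
form with matrix `[[0, 1], [1, 0]]`. The basis vectors of the vector representation are
`e_1, …, e_m` (indices `Sum.inl`, of weights `ε_1, …, ε_m`) and `e_{-1}, …, e_{-m}` (indices
`Sum.inr`, of weights `-ε_1, …, -ε_m`). -/
abbrev So : LieSubalgebra K (Matrix (Fin m ⊕ Fin m) (Fin m ⊕ Fin m) K) :=
  LieAlgebra.Orthogonal.typeD (Fin m) K

/-- The algebra `U_1(so_{2m})`, i.e. the universal enveloping algebra. -/
abbrev U : Type _ := UniversalEnvelopingAlgebra K (So K m)

/-- The vector representation space `V = K^{2m}`. -/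
abbrev Vec : Type _ := (Fin m ⊕ Fin m) → K

/-- The transposition of the indices of `e_m` and `e_{-m}`. -/
def lastSwap (m : ℕ) : Equiv.Perm (Fin m ⊕ Fin m) :=
  Function.Involutive.toPerm
    (Sum.elim (fun i => if i.val + 1 = m then Sum.inr i else Sum.inl i)
      (fun i => if i.val + 1 = m then Sum.inl i else Sum.inr i))
    (by rintro (i | i) <;> by_cases h : i.val + 1 = m <;> simp [h])

theorem lastSwap_lastSwap (i : Fin m ⊕ Fin m) : lastSwap m (lastSwap m i) = i :=
  (lastSwap m).left_inv i

theorem lastSwap_inl (i : Fin m) :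
    lastSwap m (Sum.inl i) = if i.val + 1 = m then Sum.inr i else Sum.inl i := rfl

theorem lastSwap_inr (i : Fin m) :
    lastSwap m (Sum.inr i) = if i.val + 1 = m then Sum.inl i else Sum.inr i := rfl

theorem submatrix_lastSwap_mem (X : Matrix (Fin m ⊕ Fin m) (Fin m ⊕ Fin m) K)
    (hX : X ∈ So K m) : X.submatrix (lastSwap m) (lastSwap m) ∈ So K m := by
  have hJ : (LieAlgebra.Orthogonal.JD (Fin m) K).submatrix (lastSwap m) (lastSwap m)
      = LieAlgebra.Orthogonal.JD (Fin m) K := by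
    ext (i | i) (j | j) <;> by_cases hi : i.val + 1 = m <;> by_cases hj : j.val + 1 = m <;>
      simp [LieAlgebra.Orthogonal.JD, lastSwap_inl, lastSwap_inr, hi, hj, Matrix.one_apply] <;>
      grind
  simp only [So, LieAlgebra.Orthogonal.typeD, mem_skewAdjointMatricesLieSubalgebra,
    mem_skewAdjointMatricesSubmodule, Matrix.IsSkewAdjoint, Matrix.IsAdjointPair] at hX ⊢
  have := congrArg (fun Y => Matrix.submatrix Y (lastSwap m) (lastSwap m)) hX
  simp only [← Matrix.submatrix_mul_equiv _ _ _ (lastSwap m), hJ] at this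
  exact this

/-- The diagram automorphism of `so_{2m}`: conjugation by the reflection of `V` that exchanges `e_m`
and `e_{-m}`. On weights it sends `ε_m` to `-ε_m` and fixes the other `ε_i`, and, for `m ≥ 2`, it
exchanges the Chevalley generators attached to `α_{m-1} = ε_{m-1} - ε_m` and to
`α_m = ε_{m-1} + ε_m`, fixing the others. -/
def sigmaLie : So K m →ₗ⁅K⁆ So K m where
  toFun X := ⟨(X : Matrix (Fin m ⊕ Fin m) (Fin m ⊕ Fin m) K).submatrix (lastSwap m) (lastSwap m),
    submatrix_lastSwap_mem K m _ X.2⟩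
  map_add' X Y := rfl
  map_smul' c X := rfl
  map_lie' {X Y} := by
    apply Subtype.ext
    change Matrix.submatrix ⁅(X : Matrix (Fin m ⊕ Fin m) (Fin m ⊕ Fin m) K), (Y : Matrix (Fin m ⊕ Fin m) (Fin m ⊕ Fin m) K)⁆ _ _ =
      ⁅Matrix.submatrix (X : Matrix (Fin m ⊕ Fin m) (Fin m ⊕ Fin m) K) (lastSwap m) (lastSwap m),
        Matrix.submatrix (Y : Matrix (Fin m ⊕ Fin m) (Fin m ⊕ Fin m) K) (lastSwap m) (lastSwap m)⁆
    simp only [LieRing.of_associative_ring_bracket, Matrix.submatrix_sub, Pi.sub_apply,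
      Matrix.submatrix_mul_equiv]

theorem sigmaLie_sigmaLie (X : So K m) : sigmaLie K m (sigmaLie K m X) = X := by
  apply Subtype.ext
  ext i j
  change (X : Matrix (Fin m ⊕ Fin m) (Fin m ⊕ Fin m) K) (lastSwap m (lastSwap m i)) (lastSwap m (lastSwap m j)) = _
  rw [lastSwap_lastSwap, lastSwap_lastSwap]

/-- The homomorphism of `U_1(so_{2m})` induced by the diagram automorphism. -/
def sigmaHom : U K m →ₐ[K] U K m :=
  UniversalEnvelopingAlgebra.lift K ((UniversalEnvelopingAlgebra.ι K).comp (sigmaLie K m))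

theorem sigmaHom_ι (X : So K m) : sigmaHom K m (UniversalEnvelopingAlgebra.ι K X) =
    UniversalEnvelopingAlgebra.ι K (sigmaLie K m X) := by
  rw [sigmaHom, UniversalEnvelopingAlgebra.lift_ι_apply]
  rfl

theorem sigmaHom_comp_sigmaHom : (sigmaHom K m).comp (sigmaHom K m) = AlgHom.id K (U K m) := by
  apply UniversalEnvelopingAlgebra.hom_ext
  ext X
  change sigmaHom K m (sigmaHom K m (UniversalEnvelopingAlgebra.ι K X)) =
    UniversalEnvelopingAlgebra.ι K X
  rw [sigmaHom_ι, sigmaHom_ι, sigmaLie_sigmaLie]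

/-- The involution `σ` of `U_1(so_{2m})`. -/
def sigma : U K m ≃ₐ[K] U K m :=
  AlgEquiv.ofAlgHom (sigmaHom K m) (sigmaHom K m)
    (sigmaHom_comp_sigmaHom K m) (sigmaHom_comp_sigmaHom K m)

theorem sigma_mul_sigma : sigma K m * sigma K m = 1 := by
  ext x
  exact DFunLike.congr_fun (sigmaHom_comp_sigmaHom K m) x

/-- `ℤ/2ℤ` acts on `U_1(so_{2m})`, its generator acting by `σ`. -/
instance : MulSemiringAction C2 (U K m) :=
  MulSemiringAction.compHom (U K m) (involutionHom (sigma K m) (sigma_mul_sigma K m))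

theorem smul_def (z : C2) (x : U K m) :
    z • x = involutionHom (sigma K m) (sigma_mul_sigma K m) z x := rfl

instance : SMulCommClass C2 K (U K m) where
  smul_comm z c x := by
    rw [smul_def, smul_def, map_smul]

/-- The skew group ring `Ũ_1 = U_1(so_{2m}) ⋊ K(ℤ/2ℤ)`; with `τ` the generator of `ℤ/2ℤ` its
elements are `x + y τ` with `x, y ∈ U_1(so_{2m})`, and `τ x = σ(x) τ`. -/
abbrev UTilde : Type _ := SkewMonoidAlgebra (U K m) C2

/-- The tensor power `V^{⊗d}` of the vector representation of `so_{2m}`. -/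
abbrev TPow (d : ℕ) : Type _ := ⨂[K] _ : Fin d, Vec K m

/-- The vector representation of `so_{2m}` by matrices acting on column vectors. -/
def vecLie : So K m →ₗ⁅K⁆ Module.End K (Vec K m) :=
  (lieEquivMatrix' (R := K) (n := Fin m ⊕ Fin m)).symm.toLieHom.comp (So K m).incl

theorem vecLie_apply (X : So K m) (v : Vec K m) :
    vecLie K m X v = (X : Matrix (Fin m ⊕ Fin m) (Fin m ⊕ Fin m) K).mulVec v := by
  simp [vecLie, lieEquivMatrix'_symm_apply]

/-- The action of `U_1(so_{2m})` on `V^{⊗d}`. -/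
def rho (d : ℕ) : U K m →ₐ[K] Module.End K (TPow K m d) :=
  UniversalEnvelopingAlgebra.lift K ((leibniz d).comp (vecLie K m))

/-- The action of `τ` on `V`: it exchanges `e_m` and `e_{-m}` and fixes the other basis vectors. In
particular, for `m ≥ 2`, it fixes the highest weight vector `e_1`. -/
def tauVec : Module.End K (Vec K m) := LinearMap.funLeft K K (lastSwap m)

theorem tauVec_mul_tauVec : tauVec K m * tauVec K m = 1 := by
  ext v i
  simp [tauVec, LinearMap.funLeft, lastSwap_lastSwap]

theorem vecLie_sigmaLie (X : So K m) :
    vecLie K m (sigmaLie K m X) * tauVec K m = tauVec K m * vecLie K m X := by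
  apply LinearMap.ext
  intro v
  funext i
  change vecLie K m (sigmaLie K m X) (tauVec K m v) i = tauVec K m (vecLie K m X v) i
  rw [vecLie_apply, vecLie_apply]
  change ((X : Matrix (Fin m ⊕ Fin m) (Fin m ⊕ Fin m) K).submatrix (lastSwap m) (lastSwap m)).mulVec
    (v ∘ lastSwap m) i = (X : Matrix (Fin m ⊕ Fin m) (Fin m ⊕ Fin m) K).mulVec v (lastSwap m i)
  simp only [Matrix.mulVec, dotProduct, Matrix.submatrix_apply, Function.comp_apply]
  exact Equiv.sum_comp (lastSwap m) (fun j => (X : Matrix (Fin m ⊕ Fin m) (Fin m ⊕ Fin m) K) (lastSwap m i) j * v j)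

theorem map_sigma_mul {A : Type*} [Ring A] [Algebra K A] (r : U K m →ₐ[K] A) (T : A)
    (hT : T * T = 1)
    (h : ∀ X : So K m, r (UniversalEnvelopingAlgebra.ι K (sigmaLie K m X)) * T =
      T * r (UniversalEnvelopingAlgebra.ι K X)) (x : U K m) :
    r (sigma K m x) * T = T * r x := by
  let u : Aˣ := ⟨T, T, hT, hT⟩
  let c : A →ₐ[K] A := MulSemiringAction.toAlgHom K A (ConjAct.toConjAct u)
  have hc : ∀ y, c y = T * y * T := fun y => rfl
  have key : r.comp (sigmaHom K m) = c.comp r := by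
    apply UniversalEnvelopingAlgebra.hom_ext K
    ext1 X
    change r (sigmaHom K m (UniversalEnvelopingAlgebra.ι K X)) =
      c (r (UniversalEnvelopingAlgebra.ι K X))
    rw [hc, sigmaHom_ι, ← h, mul_assoc, hT, mul_one]
  have hx := DFunLike.congr_fun key x
  change r (sigma K m x) = c (r x) at hx
  rw [hx, hc, mul_assoc, hT, mul_one]

theorem rho_ι (d : ℕ) (X : So K m) :
    rho K m d (UniversalEnvelopingAlgebra.ι K X) = leibniz d (vecLie K m X) := by
  rw [rho, UniversalEnvelopingAlgebra.lift_ι_apply]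
  rfl

theorem rho_sigma_mul (d : ℕ) (x : U K m) :
    rho K m d (sigma K m x) * diagonal d (tauVec K m) =
      diagonal d (tauVec K m) * rho K m d x := by
  refine map_sigma_mul (A := Module.End K (TPow K m d)) K m (rho K m d) (diagonal d (tauVec K m))
    (diagonal_mul_self d (tauVec_mul_tauVec K m)) (fun X => ?_) x
  rw [rho_ι, rho_ι]
  exact leibniz_mul_diagonal d (vecLie_sigmaLie K m X)

/-- The action of `Ũ_1` on `V^{⊗d}`: `U_1(so_{2m})` acts as before and `τ` acts diagonally, as
`τ ⊗ ⋯ ⊗ τ`. -/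
def rhoTilde (d : ℕ) : UTilde K m →ₐ[K] Module.End K (TPow K m d) :=
  SkewMonoidAlgebra.liftNCAlgHom (rho K m d)
    (involutionHom (diagonal d (tauVec K m)) (diagonal_mul_self d (tauVec_mul_tauVec K m)))
    (by
      intro x y
      have h : ∀ a : ZMod 2,
          rho K m d ((sigma K m ^ a.val) x) * diagonal d (tauVec K m) ^ a.val =
            diagonal d (tauVec K m) ^ a.val * rho K m d x := by
        intro a
        fin_cases a
        · change rho K m d ((sigma K m ^ 0) x) * diagonal d (tauVec K m) ^ 0 =
            diagonal d (tauVec K m) ^ 0 * rho K m d x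
          simp
        · change rho K m d ((sigma K m ^ 1) x) * diagonal d (tauVec K m) ^ 1 =
            diagonal d (tauVec K m) ^ 1 * rho K m d x
          simpa using rho_sigma_mul K m d x
      exact h _)

end

end SchurWeylD

/-! Lowering indices by the form identifies `End(V^{⊗d})` with the tensors in `2d` slots
(`toTensor`), and turns both commutants into spaces of invariant tensors. Each of them has as a
basis the products of pairings indexed by the perfect matchings of the `2d` slots, so each dimension
is the number of matchings, which depends on `d` alone.

Spanning is the first fundamental theorem for the orthogonal group, `IsOrthInv.mem_matchSpan`,
proved by induction on the set of basis vectors of nonzero norm in an orthogonal basis. Put a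
generic vector `x` in one slot of an invariant `f`, and let `q = (x,x)`. At `x = u_e` the values are
governed by invariants of the complement of `u_e`, known by induction. These lift to products of
pairings `(v_s,v_t)`, linear forms `(v_s,x)` and `q`, because `(x,x)(v_s,v_t) - (v_s,x)(v_t,x)`
restricts at `x = u_e` to `(u_e,u_e)` times the pairing of the complement. A homogeneous invariant
function is determined by its value at one anisotropic vector (`eq_zero_of_coeff_single`), so `q^p`
times the polarised tensor is a combination of such products. The polarised tensor is linear in `x`,
hence harmonic, and the Laplacian strips off the powers of `q` (`mem_genSpan_of_quad_pow_mul_mem`).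
Differentiating at `x = 0` recovers `f`.

Passing from the Lie algebra to the full orthogonal group is a question of parity. In a hyperbolic
plane spanned by vectors of opposite norms, an infinitesimal rotation is a multiple of a swap, which
forces these two vectors to occur an even number of times in total (`IsRotInv.eq_zero_of_odd_add`).
Hence all basis vectors occur with the same parity, and one vector known to occur evenly suffices.
For the skew group ring, `τ` is the reflection in one basis vector and gives this. For `m' > d`,
some basis vector is missing among the `2d` indices.

For independence, the `d` pairs of a matching are labelled by distinct vectors among the `2m ≥ d`
basis vectors. On that index vector only this matching has a nonzero tensor. -/

namespace OrthInv

open Finset MvPolynomial Function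

set_option linter.unusedSectionVars false

noncomputable section

variable {K n ι R : Type*} [Field K] [Fintype n] [DecidableEq n] [DecidableEq ι]
  [CommRing R] [Algebra K R]

/-! ### Infinitesimal rotations of tensors -/

/-- A function `g : (ι → n) → R` is regarded as a tensor with slots `ι`, given by its values on an
orthogonal basis indexed by `n` whose vectors have norms `w`. This is the action on the slots in `S`
of the infinitesimal rotation `u_b ↦ w_b u_a`, `u_a ↦ -w_a u_b`. -/
def rot (w : n → K) (S : Finset ι) (a b : n) (g : (ι → n) → R) (i : ι → n) : R :=
  ∑ s ∈ S, ((if i s = b then w b • g (update i s a) else 0) -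
    (if i s = a then w a • g (update i s b) else 0))

/-- The tensor `g` involves only the slots in `S`, and is killed by the rotation of these slots
combined with the derivation `r` of the coefficients. -/
structure IsRotInv (w : n → K) (r : n → n → Derivation K R R) (S : Finset ι)
    (g : (ι → n) → R) : Prop where
  dep : ∀ i j : ι → n, (∀ s ∈ S, i s = j s) → g i = g j
  rot_eq : ∀ a b i, rot w S a b g i + r a b (g i) = 0

theorem IsRotInv.update_eq {w : n → K} {r : n → n → Derivation K R R} {S : Finset ι}
    {g : (ι → n) → R} (h : IsRotInv w r S g) {s : ι} (hs : s ∉ S) (i : ι → n) (a : n) :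
    g (update i s a) = g i :=
  h.dep _ _ fun _ ht => update_of_ne (ne_of_mem_of_not_mem ht hs) _ _

/-- The rotation obeys the Leibniz rule: since the slots are disjoint, each summand alters only one
factor, just as the derivation of the coefficients does. -/
theorem IsRotInv.mul {w : n → K} {r : n → n → Derivation K R R} {S T : Finset ι}
    {g h : (ι → n) → R} (hg : IsRotInv w r S g) (hh : IsRotInv w r T h) (hST : Disjoint S T) :
    IsRotInv w r (S ∪ T) (g * h) where
  dep i j hij := by
    rw [Pi.mul_apply, Pi.mul_apply, hg.dep i j fun s hs => hij s (mem_union_left _ hs),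
      hh.dep i j fun s hs => hij s (mem_union_right _ hs)]
  rot_eq a b i := by
    have h1 := hg.rot_eq a b i
    have h2 := hh.rot_eq a b i
    have e1 : rot w (S ∪ T) a b (g * h) i = rot w S a b g i * h i + g i * rot w T a b h i := by
      rw [rot, sum_union hST, rot, rot, sum_mul, mul_sum]
      congr 1
      · refine sum_congr rfl fun s hs => ?_
        simp only [Pi.mul_apply, hh.update_eq (disjoint_left.1 hST hs)]
        split_ifs <;> simp [sub_mul]
      · refine sum_congr rfl fun s hs => ?_
        simp only [Pi.mul_apply, hg.update_eq (disjoint_right.1 hST hs)]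
        split_ifs <;> simp [mul_sub]
    rw [e1, Pi.mul_apply, Derivation.leibniz, smul_eq_mul, smul_eq_mul]
    linear_combination h i * h1 + g i * h2

theorem rot_add (w : n → K) (S : Finset ι) (a b : n) (g h : (ι → n) → R) (i : ι → n) :
    rot w S a b (g + h) i = rot w S a b g i + rot w S a b h i := by
  rw [rot, rot, rot, ← sum_add_distrib]
  refine sum_congr rfl fun s _ => ?_
  split_ifs <;> simp <;> abel

theorem rot_smul (w : n → K) (S : Finset ι) (a b : n) (c : K) (g : (ι → n) → R) (i : ι → n) :
    rot w S a b (c • g) i = c • rot w S a b g i := by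
  rw [rot, rot, smul_sum]
  refine sum_congr rfl fun s _ => ?_
  split_ifs <;> simp [smul_sub, smul_comm c]

/-- The invariant tensors form a submodule. -/
def rotInvSubmodule (w : n → K) (r : n → n → Derivation K R R) (S : Finset ι) :
    Submodule K ((ι → n) → R) where
  carrier := {g | IsRotInv w r S g}
  zero_mem' := ⟨fun _ _ _ => rfl, fun a b i => by simp [rot]⟩
  add_mem' {g h} hg hh := ⟨fun i j hij => by
      rw [Pi.add_apply, Pi.add_apply, hg.dep i j hij, hh.dep i j hij], fun a b i => by
      rw [rot_add, Pi.add_apply, map_add]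
      linear_combination hg.rot_eq a b i + hh.rot_eq a b i⟩
  smul_mem' c g hg := ⟨fun i j hij => by
      rw [Pi.smul_apply, Pi.smul_apply, hg.dep i j hij], fun a b i => by
      rw [rot_smul, Pi.smul_apply, Derivation.map_smul, ← smul_add, hg.rot_eq a b i, smul_zero]⟩

/-! ### Matching tensors -/

/-- The values on basis vectors of the bilinear form in slots `s` and `t`. -/
def pairing (w : n → K) (s t : ι) (i : ι → n) : K := if i s = i t then w (i s) else 0

theorem pairing_comm (w : n → K) (s t : ι) : pairing w s t = pairing w t s := by
  funext i
  by_cases h : i s = i t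
  · simp [pairing, h]
  · simp [pairing, h, Ne.symm h]

/-- The rotations are skew for the form. Vanishing weights are harmless, which lets the same
formalism treat the complement of a basis vector. -/
theorem isRotInv_pairing (w : n → K) (r : n → n → Derivation K R R) {s t : ι} (hst : s ≠ t) :
    IsRotInv w r {s, t} (fun i => algebraMap K R (pairing w s t i)) where
  dep i j hij := by
    simp only [pairing, hij s (by simp), hij t (by simp)]
  rot_eq a b i := by
    rw [Derivation.map_algebraMap, add_zero, rot, sum_pair hst]
    simp only [pairing, update_self, update_of_ne hst, update_of_ne hst.symm, Algebra.smul_def,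
      ← map_mul]
    have : ∀ x y z t : K, (algebraMap K R x - algebraMap K R y + (algebraMap K R z - algebraMap K R t))
      = algebraMap K R (x - y + (z - t)) := by intros; simp
    simp only [← apply_ite (algebraMap K R), ← map_zero (algebraMap K R), this]
    congr 1
    grind

/-- The perfect matchings of `S`, as sets of unordered pairs. -/
inductive IsMatching : Finset ι → Finset (Sym2 ι) → Prop
  | empty : IsMatching ∅ ∅
  | insert {S : Finset ι} {M : Finset (Sym2 ι)} {s t : ι} : s ∉ S → t ∉ S → s ≠ t →
      IsMatching S M → IsMatching (insert s (insert t S)) (insert s(s, t) M)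

/-- The pairing attached to an unordered pair of slots. -/
def symPairing (w : n → K) (i : ι → n) : Sym2 ι → K :=
  Sym2.lift ⟨fun s t => pairing w s t i, fun s t => congrFun (pairing_comm w s t) i⟩

/-- The tensor attached to a matching. -/
def matchTensor (w : n → K) (M : Finset (Sym2 ι)) (i : ι → n) : K := ∏ z ∈ M, symPairing w i z

/-- The span of the tensors attached to the matchings of `S`. -/
def matchSpan (w : n → K) (S : Finset ι) : Submodule K ((ι → n) → K) :=
  Submodule.span K (matchTensor w '' {M | IsMatching S M})

theorem IsMatching.mem_of_mem {S : Finset ι} {M : Finset (Sym2 ι)} (h : IsMatching S M) :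
    ∀ z ∈ M, ∀ s ∈ z, s ∈ S := by
  induction h with
  | empty => simp
  | insert hs ht hst h ih =>
    intro z hz u hu
    rcases mem_insert.1 hz with rfl | hz
    · rcases Sym2.mem_iff.1 hu with rfl | rfl <;> simp
    · simp [ih z hz u hu]

theorem matchTensor_empty (w : n → K) : matchTensor w (∅ : Finset (Sym2 ι)) = 1 := by
  funext i; simp [matchTensor]

theorem matchTensor_insert (w : n → K) {S : Finset ι} {M : Finset (Sym2 ι)} {s t : ι} (hs : s ∉ S)
    (h : IsMatching S M) : matchTensor w (insert s(s, t) M) = pairing w s t * matchTensor w M := by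
  funext i
  rw [matchTensor, prod_insert fun hM => hs (h.mem_of_mem _ hM s (by simp))]
  rfl

theorem pairing_mul_mem_matchSpan (w : n → K) {S : Finset ι} {s t : ι} (hs : s ∉ S) (ht : t ∉ S)
    (hst : s ≠ t) {g : (ι → n) → K} (hg : g ∈ matchSpan w S) :
    pairing w s t * g ∈ matchSpan w (insert s (insert t S)) := by
  induction hg using Submodule.span_induction with
  | mem g hg =>
    obtain ⟨M, hM, rfl⟩ := hg
    rw [← matchTensor_insert w hs hM]
    exact Submodule.subset_span ⟨_, hM.insert hs ht hst, rfl⟩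
  | zero => simp
  | add g h _ _ hg hh => rw [mul_add]; exact add_mem hg hh
  | smul c g _ hg => rw [mul_smul_comm]; exact Submodule.smul_mem _ _ hg

theorem one_mem_matchSpan (w : n → K) : (1 : (ι → n) → K) ∈ matchSpan w ∅ :=
  Submodule.subset_span ⟨∅, .empty, matchTensor_empty w⟩

theorem matchSpan_le_rotInvSubmodule (w : n → K) (S : Finset ι) :
    matchSpan w S ≤ rotInvSubmodule w 0 S := by
  refine Submodule.span_le.2 ?_
  rintro _ ⟨M, hM, rfl⟩
  induction hM with
  | empty =>
    rw [matchTensor_empty]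
    exact ⟨fun _ _ _ => rfl, fun a b i => by simp [rot]⟩
  | @insert S M s t hs ht hst h ih =>
    rw [matchTensor_insert w hs h]
    have := (isRotInv_pairing (R := K) w 0 hst).mul ih (by simp [hs, ht])
    rw [insert_union, singleton_union] at this
    exact this

/-! ### Products of pairings, coordinates and the quadratic form -/

/-- The linear form `x ↦ (u_{i_s}, x)` in a further vector `x`. -/
def lin (w : n → K) (s : ι) (i : ι → n) : MvPolynomial n K := C (w (i s)) * X (i s)

/-- The quadratic form `x ↦ (x, x)`. -/
def quad (w : n → K) : MvPolynomial n K := ∑ a, C (w a) * X a ^ 2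

/-- The rotations acting on the polynomials in `x`. -/
def rotDer (w : n → K) (a b : n) : Derivation K (MvPolynomial n K) (MvPolynomial n K) :=
  (C (w b) * X b : MvPolynomial n K) • pderiv a - (C (w a) * X a : MvPolynomial n K) • pderiv b

theorem rotDer_apply (w : n → K) (a b : n) (p : MvPolynomial n K) :
    rotDer w a b p = C (w b) * X b * pderiv a p - C (w a) * X a * pderiv b p := rfl

theorem pderiv_quad (w : n → K) (a : n) : pderiv a (quad w) = 2 * (C (w a) * X a) := by
  rw [quad, map_sum, sum_eq_single a]
  · rw [pderiv_C_mul, pderiv_pow, pderiv_X_self]; push_cast; ring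
  · intro b _ hb
    rw [pderiv_C_mul, pderiv_pow, pderiv_X_of_ne hb]; ring
  · simp

theorem pderiv_lin (w : n → K) (s : ι) (i : ι → n) (a : n) :
    pderiv a (lin w s i) = if i s = a then C (w a) else 0 := by
  rw [lin, pderiv_C_mul]
  split_ifs with h
  · rw [h, pderiv_X_self, mul_one]
  · rw [pderiv_X_of_ne h, mul_zero]

/-- The products of pairings and linear forms using each slot in `S` once, multiplied by a power of
the quadratic form. -/
inductive IsGen (w : n → K) : Finset ι → ((ι → n) → MvPolynomial n K) → Prop
  | one : IsGen w ∅ 1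
  | quad {S : Finset ι} {g : (ι → n) → MvPolynomial n K} : IsGen w S g →
      IsGen w S (fun i => quad w * g i)
  | lin {S : Finset ι} {g : (ι → n) → MvPolynomial n K} {s : ι} : s ∉ S → IsGen w S g →
      IsGen w (insert s S) (fun i => lin w s i * g i)
  | pair {S : Finset ι} {g : (ι → n) → MvPolynomial n K} {s t : ι} : s ∉ S → t ∉ S → s ≠ t →
      IsGen w S g → IsGen w (insert s (insert t S)) (fun i => C (pairing w s t i) * g i)

/-- The span of the functions in `IsGen`. -/
def genSpan (w : n → K) (S : Finset ι) : Submodule K ((ι → n) → MvPolynomial n K) :=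
  Submodule.span K {g | IsGen w S g}

theorem IsGen.mem {w : n → K} {S : Finset ι} {g : (ι → n) → MvPolynomial n K} (h : IsGen w S g) :
    g ∈ genSpan w S :=
  Submodule.subset_span h

theorem genSpan_map_mem {w : n → K} {S T : Finset ι}
    (φ : ((ι → n) → MvPolynomial n K) →ₗ[K] ((ι → n) → MvPolynomial n K))
    (hφ : ∀ g, IsGen w S g → φ g ∈ genSpan w T) {g : (ι → n) → MvPolynomial n K}
    (hg : g ∈ genSpan w S) : φ g ∈ genSpan w T :=
  (Submodule.span_le (p := (genSpan w T).comap φ)).2 hφ hg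

theorem quad_mul_mem {w : n → K} {S : Finset ι} {g : (ι → n) → MvPolynomial n K}
    (hg : g ∈ genSpan w S) : (fun i => quad w * g i) ∈ genSpan w S :=
  genSpan_map_mem (LinearMap.mulLeft K (fun _ => quad w))
    (fun _ h => h.quad.mem) hg

theorem lin_mul_mem {w : n → K} {S : Finset ι} {g : (ι → n) → MvPolynomial n K} {s : ι}
    (hs : s ∉ S) (hg : g ∈ genSpan w S) : (fun i => lin w s i * g i) ∈ genSpan w (insert s S) :=
  genSpan_map_mem (LinearMap.mulLeft K (lin w s)) (fun _ h => (h.lin hs).mem) hg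

theorem pair_mul_mem {w : n → K} {S : Finset ι} {g : (ι → n) → MvPolynomial n K} {s t : ι}
    (hs : s ∉ S) (ht : t ∉ S) (hst : s ≠ t) (hg : g ∈ genSpan w S) :
    (fun i => C (pairing w s t i) * g i) ∈ genSpan w (insert s (insert t S)) :=
  genSpan_map_mem (LinearMap.mulLeft K (fun i => C (pairing w s t i)))
    (fun _ h => (h.pair hs ht hst).mem) hg

theorem isRotInv_lin (w : n → K) (s : ι) : IsRotInv w (rotDer w) {s} (lin w s) where
  dep i j hij := by simp only [lin, hij s (by simp)]
  rot_eq a b i := by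
    rw [rot, sum_singleton, rotDer_apply, pderiv_lin, pderiv_lin]
    simp only [lin, update_self, smul_eq_C_mul]
    split_ifs <;> ring

theorem isRotInv_quad (w : n → K) :
    IsRotInv w (rotDer w) (∅ : Finset ι) (fun _ => quad w) where
  dep i j hij := rfl
  rot_eq a b i := by
    rw [rot, sum_empty, rotDer_apply, pderiv_quad, pderiv_quad]
    ring

/-- Needed so that the difference between a polarised tensor and its candidate expression is again
invariant, and rigidity applies to it. -/
theorem genSpan_le_rotInvSubmodule (w : n → K) (S : Finset ι) :
    genSpan w S ≤ rotInvSubmodule w (rotDer w) S := by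
  refine Submodule.span_le.2 fun g hg => ?_
  induction hg with
  | one => exact ⟨fun _ _ _ => rfl, fun a b i => by simp [rot]⟩
  | quad h ih =>
    have := (isRotInv_quad w).mul ih (by simp)
    rwa [empty_union] at this
  | lin hs h ih =>
    have := (isRotInv_lin w _).mul ih (by simpa using hs)
    rwa [singleton_union] at this
  | pair hs ht hst h ih =>
    have := (isRotInv_pairing w (rotDer w) hst).mul ih (by simp [hs, ht])
    rw [insert_union, singleton_union] at this
    exact this

/-! ### The Laplacian -/

/-- The Euler operator, restricted to the coordinates with nonzero weight. -/
def euler (w : n → K) : Derivation K (MvPolynomial n K) (MvPolynomial n K) :=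
  ∑ a, (C (w a * (w a)⁻¹) * X a : MvPolynomial n K) • pderiv a

theorem euler_apply (w : n → K) (p : MvPolynomial n K) :
    euler w p = ∑ a, C (w a * (w a)⁻¹) * X a * pderiv a p := by
  have h : ∀ T : Finset n, (∑ a ∈ T, (C (w a * (w a)⁻¹) * X a : MvPolynomial n K) • pderiv a) p =
      ∑ a ∈ T, C (w a * (w a)⁻¹) * X a * pderiv a p := fun T => by
    induction T using Finset.induction_on with
    | empty => simp
    | insert a T ha ih =>
      rw [sum_insert ha, sum_insert ha, Derivation.add_apply, ih]
      rfl
  exact h univ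

/-- The Laplacian of the quadratic form. -/
def lap (w : n → K) : MvPolynomial n K →ₗ[K] MvPolynomial n K :=
  ∑ a, (w a)⁻¹ • (pderiv a).toLinearMap ∘ₗ (pderiv a).toLinearMap

theorem lap_apply (w : n → K) (p : MvPolynomial n K) :
    lap w p = ∑ a, C (w a)⁻¹ * pderiv a (pderiv a p) := by
  simp [lap, LinearMap.sum_apply, smul_eq_C_mul]

theorem lap_mul (w : n → K) (p q : MvPolynomial n K) :
    lap w (p * q) = lap w p * q + 2 * ∑ a, C (w a)⁻¹ * (pderiv a p * pderiv a q) + p * lap w q := by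
  simp only [lap_apply, sum_mul, mul_sum, ← sum_add_distrib]
  refine sum_congr rfl fun a _ => ?_
  simp only [pderiv_mul, map_add]
  ring

theorem mul_inv_mul_self (x : K) : x * x⁻¹ * x = x := by
  by_cases h : x = 0 <;> simp [h]

/-- With `0⁻¹ = 0`, the sum of the `w a * (w a)⁻¹` counts the nonzero weights: it is the dimension
of the nondegenerate part, as in the classical formula. -/
theorem lap_quad_mul (w : n → K) (p : MvPolynomial n K) :
    lap w (quad w * p) =
      C (2 * ∑ a, w a * (w a)⁻¹) * p + 4 * euler w p + quad w * lap w p := by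
  rw [lap_mul]
  congr 2
  · rw [lap_apply]
    congr 1
    simp only [pderiv_quad, map_mul, map_sum, mul_sum]
    refine sum_congr rfl fun a _ => ?_
    have : (2 : MvPolynomial n K) = C 2 := (map_ofNat C 2).symm
    rw [this, pderiv_C_mul, pderiv_C_mul, pderiv_X_self]
    ring
  · rw [euler_apply, mul_sum, mul_sum]
    refine sum_congr rfl fun a _ => ?_
    rw [pderiv_quad, map_mul]
    ring

theorem lap_lin_mul (w : n → K) (s : ι) (i : ι → n) (p : MvPolynomial n K) :
    lap w (lin w s i * p) =
      2 * (C (w (i s) * (w (i s))⁻¹) * pderiv (i s) p) + lin w s i * lap w p := by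
  rw [lap_mul]
  have h1 : lap w (lin w s i) = 0 := by
    rw [lap_apply]
    refine sum_eq_zero fun a _ => ?_
    rw [pderiv_lin]
    split_ifs <;> simp
  rw [h1, zero_mul, zero_add]
  congr 2
  rw [sum_eq_single (i s)]
  · rw [pderiv_lin, if_pos rfl, map_mul]; ring
  · intro b _ hb
    rw [pderiv_lin, if_neg hb.symm]; simp
  · simp

theorem lap_C_mul (w : n → K) (c : K) (p : MvPolynomial n K) :
    lap w (C c * p) = C c * lap w p := by
  rw [← smul_eq_C_mul, map_smul, smul_eq_C_mul]

theorem euler_quad (w : n → K) : euler w (quad w) = 2 * quad w := by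
  rw [euler_apply, quad, mul_sum]
  refine sum_congr rfl fun a _ => ?_
  rw [← quad, pderiv_quad]
  conv_rhs => rw [← mul_inv_mul_self (w a), map_mul]
  ring

theorem euler_lin (w : n → K) (s : ι) (i : ι → n) : euler w (lin w s i) = lin w s i := by
  rw [euler_apply, sum_eq_single (i s)]
  · rw [pderiv_lin, if_pos rfl, lin]
    conv_rhs => rw [← mul_inv_mul_self (w (i s)), map_mul]
    ring
  · intro b _ hb
    rw [pderiv_lin, if_neg hb.symm, mul_zero]
  · simp

theorem euler_mem {w : n → K} {S : Finset ι} {g : (ι → n) → MvPolynomial n K}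
    (hg : g ∈ genSpan w S) : (fun i => euler w (g i)) ∈ genSpan w S := by
  refine genSpan_map_mem ((euler w).toLinearMap.compLeft (ι → n)) (fun g hg' => ?_) hg
  clear hg
  change (fun i => euler w (g i)) ∈ _
  induction hg' with
  | one => convert zero_mem (genSpan w (∅ : Finset ι)); simp
  | @quad S g h ih =>
    convert add_mem (Submodule.smul_mem _ (2 : K) h.quad.mem) (quad_mul_mem ih)
      using 1
    funext i
    simp only [Derivation.leibniz, euler_quad, Pi.add_apply, Pi.smul_apply, smul_eq_mul,
      smul_eq_C_mul, map_ofNat]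
    ring
  | @lin S g s hs h ih =>
    convert add_mem (h.lin hs).mem (lin_mul_mem hs ih) using 1
    funext i
    simp only [Derivation.leibniz, euler_lin, Pi.add_apply, smul_eq_mul]
    ring
  | @pair S g s t hs ht hst h ih =>
    convert pair_mul_mem hs ht hst ih using 1
    funext i
    simp only [← smul_eq_C_mul, Derivation.map_smul]

/-- Feeding the gradient into a new slot `s` turns a factor `quad` into twice a linear form and a
linear form into a pairing. This is the cross term of the Laplacian of `lin w s i * g i`; the factor
`w * w⁻¹` discards the degenerate directions. -/
theorem gradient_mem {w : n → K} {S : Finset ι} {g : (ι → n) → MvPolynomial n K}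
    (hg : g ∈ genSpan w S) {s : ι} (hs : s ∉ S) :
    (fun i => C (w (i s) * (w (i s))⁻¹) * pderiv (i s) (g i)) ∈ genSpan w (insert s S) := by
  let φ : ((ι → n) → MvPolynomial n K) →ₗ[K] ((ι → n) → MvPolynomial n K) :=
    { toFun g i := C (w (i s) * (w (i s))⁻¹) * pderiv (i s) (g i)
      map_add' g h := by funext i; simp [mul_add]
      map_smul' c g := by funext i; simp [smul_eq_C_mul]; ring }
  refine genSpan_map_mem φ (fun g hg' => ?_) hg
  clear hg
  change (fun i => C (w (i s) * (w (i s))⁻¹) * pderiv (i s) (g i)) ∈ _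
  induction hg' with
  | one => convert zero_mem (genSpan w (insert s (∅ : Finset ι))); simp
  | @quad S g h ih =>
    convert add_mem (Submodule.smul_mem _ (2 : K) (lin_mul_mem hs h.mem))
      (quad_mul_mem (ih hs)) using 1
    funext i
    simp only [pderiv_mul, pderiv_quad, Pi.add_apply, Pi.smul_apply,
      smul_eq_C_mul, map_ofNat, lin]
    have key : (C (w (i s) * (w (i s))⁻¹) * C (w (i s)) : MvPolynomial n K) = C (w (i s)) := by
      rw [← map_mul, mul_inv_mul_self]
    linear_combination 2 * X (i s) * g i * key
  | @lin S g t ht h ih =>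
    have hst : s ≠ t := fun h => hs (by simp [h])
    have hs' : s ∉ S := fun h => hs (by simp [h])
    have h2 := lin_mul_mem (w := w) (s := t) (by simp [ht, hst.symm]) (ih hs')
    rw [insert_comm] at h2
    convert add_mem (pair_mul_mem hs' ht hst h.mem) h2 using 1
    funext i
    simp only [pderiv_mul, pderiv_lin, Pi.add_apply, pairing]
    by_cases hi : i s = i t
    · rw [if_pos hi.symm, if_pos hi, mul_add, ← mul_assoc, ← map_mul, mul_inv_mul_self]
      ring
    · rw [if_neg (Ne.symm hi), if_neg hi, map_zero]
      ring
  | @pair S g t u ht hu htu h ih =>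
    simp only [mem_insert, not_or] at hs
    have h2 := pair_mul_mem (w := w) (s := t) (t := u) (by simp [ht, Ne.symm hs.1])
      (by simp [hu, Ne.symm hs.2.1]) htu (ih hs.2.2)
    rw [insert_comm u s, insert_comm t s] at h2
    convert h2 using 1
    funext i
    rw [pderiv_C_mul]
    ring

theorem lap_mem {w : n → K} {S : Finset ι} {g : (ι → n) → MvPolynomial n K}
    (hg : g ∈ genSpan w S) : (fun i => lap w (g i)) ∈ genSpan w S := by
  refine genSpan_map_mem ((lap w).compLeft (ι → n)) (fun g hg' => ?_) hg
  clear hg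
  change (fun i => lap w (g i)) ∈ _
  induction hg' with
  | one =>
    convert zero_mem (genSpan w (∅ : Finset ι))
    simp [lap_apply]
  | @quad S g h ih =>
    have hg := h.mem
    convert add_mem (add_mem (Submodule.smul_mem _ (2 * ∑ a, w a * (w a)⁻¹) hg)
      (Submodule.smul_mem _ (4 : K) (euler_mem hg))) (quad_mul_mem ih) using 1
    funext i
    simp only [lap_quad_mul, Pi.add_apply, Pi.smul_apply, smul_eq_C_mul, map_ofNat]
  | @lin S g s hs h ih =>
    convert add_mem (Submodule.smul_mem _ (2 : K) (gradient_mem h.mem hs))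
      (lin_mul_mem hs ih) using 1
    funext i
    simp only [lap_lin_mul, Pi.add_apply, Pi.smul_apply, smul_eq_C_mul, map_ofNat]
  | @pair S g s t hs ht hst h ih =>
    convert pair_mul_mem hs ht hst ih using 1
    funext i
    rw [lap_C_mul]

/-! ### Rigidity of invariant functions -/

theorem coeff_rot_eq_zero {w : n → K} {S : Finset ι} {a b : n} {D : (ι → n) → MvPolynomial n K}
    {β : n →₀ ℕ} (h : ∀ i, coeff β (D i) = 0) (i : ι → n) : coeff β (rot w S a b D i) = 0 := by
  rw [rot, coeff_sum]
  refine sum_eq_zero fun s _ => ?_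
  split_ifs <;> simp [h]

/-- An invariant function whose values are homogeneous in `x` vanishes if it vanishes at a single
anisotropic vector `x = u_e`. -/
theorem eq_zero_of_coeff_single [CharZero K] {w : n → K} {S : Finset ι} {e : n} (he : w e ≠ 0)
    {N : ℕ} {D : (ι → n) → MvPolynomial n K} (hD : IsRotInv w (rotDer w) S D)
    (hN : ∀ i, (D i).IsHomogeneous N) (hc : ∀ i, coeff (Finsupp.single e N) (D i) = 0) :
    D = 0 := by
  have key : ∀ k : ℕ, ∀ β : n →₀ ℕ, β.degree = N → β e + k = N → ∀ i, coeff β (D i) = 0 := by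
    intro k
    induction k using Nat.strong_induction_on with
    | _ k ih =>
      intro β hβ hk i
      by_cases hb : ∃ b, b ≠ e ∧ β b ≠ 0
      · obtain ⟨b, hbe, hb⟩ := hb
        have hle : Finsupp.single b 1 ≤ β := by
          rw [Finsupp.single_le_iff]; omega
        obtain ⟨δ, rfl⟩ := exists_add_of_le hle
        have hδe : (Finsupp.single b 1 + δ : n →₀ ℕ) e = δ e := by
          simp [Finsupp.single_eq_of_ne hbe.symm]
        rw [hδe] at hk
        have hdeg : δ.degree + 1 = N := by
          rw [← hβ]; simp [add_comm]
        have hk0 : k ≠ 0 := by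
          rintro rfl
          have := Finsupp.le_degree e δ
          omega
        -- The rotation in the plane of `b` and `e` trades one `X b` for one `X e`. At this
        -- exponent, the wanted coefficient of `D i` appears with the factor `w e * (δ b + 1)`, and
        -- the slot terms involve one more power of `X e`.
        have h0 := congrArg (coeff (δ + Finsupp.single e 1)) (hD.rot_eq b e i)
        rw [coeff_add, coeff_rot_eq_zero (β := δ + Finsupp.single e 1)
          (ih (k - 1) (by omega) _ (by simp [hdeg]) (by simp; omega)), zero_add, rotDer_apply,
          coeff_sub, mul_assoc, mul_assoc, coeff_C_mul, coeff_C_mul, add_comm δ, coeff_X_mul,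
          coeff_pderiv, coeff_zero] at h0
        -- This term either has no contribution or involves a coefficient with two more powers of `X
        -- e`, which explains the strong induction.
        have h1 : coeff (Finsupp.single e 1 + δ) (X b * pderiv e (D i)) = 0 := by
          by_cases hδb : δ b = 0
          · rw [coeff_X_mul', if_neg]
            simp [hδb, Finsupp.single_eq_of_ne hbe]
          · have hle : Finsupp.single b 1 ≤ δ := by
              rw [Finsupp.single_le_iff]; omega
            obtain ⟨γ, rfl⟩ := exists_add_of_le hle
            have hγe : (Finsupp.single b 1 + γ : n →₀ ℕ) e = γ e := by
              simp [Finsupp.single_eq_of_ne hbe.symm]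
            have hγ : γ.degree + 2 = N := by
              rw [← hdeg]; simp; ring
            have := Finsupp.le_degree e γ
            rw [hγe] at hk
            rw [add_left_comm, coeff_X_mul, coeff_pderiv, ih (k - 2) (by omega), zero_mul]
            · rw [← hγ]; simp; ring
            · simp; omega
        rw [h1, mul_zero, sub_zero, add_comm δ] at h0
        have h2 : ((δ b : K) + 1) ≠ 0 := Nat.cast_add_one_ne_zero (δ b)
        simpa [he, h2] using h0
      · push Not at hb
        have hβe : β = Finsupp.single e (β e) := by
          ext b
          by_cases h : b = e
          · subst h; simp
          · rw [hb b h, Finsupp.single_eq_of_ne h]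
        have : β e = N := by
          rw [← hβ, hβe]; simp
        rw [hβe, this]
        exact hc i
  funext i
  ext β
  by_cases hβ : β.degree = N
  · have := Finsupp.le_degree e β
    exact key (N - β e) β hβ (by omega) i
  · exact (hN i).coeff_eq_zero hβ

/-! ### Lifting matchings of the orthogonal complement of `u_e` -/

/-- For a homogeneous polynomial the coefficient of the pure power of `X e` is its value at `x =
u_e`, and evaluation is multiplicative. -/
theorem coeff_single_mul (e : n) {p q : MvPolynomial n K} {k l : ℕ} (hp : p.IsHomogeneous k)
    (hq : q.IsHomogeneous l) : coeff (Finsupp.single e (k + l)) (p * q) =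
      coeff (Finsupp.single e k) p * coeff (Finsupp.single e l) q := by
  rw [coeff_mul, sum_eq_single (Finsupp.single e k, Finsupp.single e l)]
  · rintro ⟨x, y⟩ hxy hne
    rw [HasAntidiagonal.mem_antidiagonal] at hxy
    simp only at hxy ⊢
    by_cases hx : x.degree = k
    · by_cases hy : y.degree = l
      · have h : ∀ z : n →₀ ℕ, z ≤ Finsupp.single e (k + l) → z = Finsupp.single e z.degree := by
          intro z hz
          have hz' : z = Finsupp.single e (z e) := by
            ext b
            by_cases hb : b = e
            · subst hb; simp
            · have := hz b
              rw [Finsupp.single_eq_of_ne hb] at this ⊢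
              omega
          rw [hz']; simp
        refine absurd ?_ hne
        rw [h x (hxy ▸ le_self_add), h y (hxy ▸ le_add_self), hx, hy]
      · rw [hq.coeff_eq_zero hy, mul_zero]
    · rw [hp.coeff_eq_zero hx, zero_mul]
  · intro h
    exact absurd (HasAntidiagonal.mem_antidiagonal.2 (Finsupp.single_add e k l).symm) h

theorem isHomogeneous_lin (w : n → K) (s : ι) (i : ι → n) : (lin w s i).IsHomogeneous 1 := by
  simpa [lin] using (isHomogeneous_C n (w (i s))).mul (isHomogeneous_X K (i s))

theorem isHomogeneous_quad (w : n → K) : (quad w).IsHomogeneous 2 :=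
  IsHomogeneous.sum _ _ _ fun a _ => by
    simpa using (isHomogeneous_C n (w a)).mul ((isHomogeneous_X K a).pow 2)

theorem coeff_single_lin (w : n → K) (e : n) (s : ι) (i : ι → n) :
    coeff (Finsupp.single e 1) (lin w s i) = if i s = e then w e else 0 := by
  rw [lin, coeff_C_mul, coeff_X]
  by_cases h : i s = e
  · simp [h]
  · simp [h, Finsupp.single_left_inj]

theorem coeff_single_quad (w : n → K) (e : n) :
    coeff (Finsupp.single e 2) (quad w) = w e := by
  rw [quad, coeff_sum, sum_eq_single e]
  · rw [coeff_C_mul, X_pow_eq_monomial, coeff_monomial, if_pos rfl, mul_one]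
  · intro b _ hb
    rw [coeff_C_mul, X_pow_eq_monomial, coeff_monomial, if_neg, mul_zero]
    rwa [Finsupp.single_left_inj (by norm_num)]
  · simp

/-- A linear combination of matching tensors for the complement of `u_e` is the value at `x = u_e`
of an invariant function. -/
theorem exists_lift {w : n → K} {e : n} (he : w e ≠ 0) {S : Finset ι} {g : (ι → n) → K}
    (hg : g ∈ matchSpan (update w e 0) S) : ∃ G ∈ genSpan w S,
      (∀ i, (G i).IsHomogeneous S.card) ∧ ∀ i, coeff (Finsupp.single e S.card) (G i) = g i := by
  induction hg using Submodule.span_induction with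
  | mem g hg =>
    obtain ⟨M, hM, rfl⟩ := hg
    induction hM with
    | empty =>
      refine ⟨1, IsGen.one.mem, fun i => isHomogeneous_one _ _, fun i => ?_⟩
      simp [matchTensor_empty]
    | @insert S M s t hs ht hst h ih =>
      obtain ⟨G, hG, hh, hc⟩ := ih
      have hs' : s ∉ insert t S := by simp [hs, hst]
      have hcard : (insert s (insert t S)).card = 2 + S.card := by
        rw [card_insert_of_notMem hs', card_insert_of_notMem ht]; omega
      -- The Gram determinant of the pairs `(x, v_s)` and `(x, v_t)`: at `x = u_e` it equals `w e`
      -- times the pairing on the complement, whence the factor `(w e)⁻¹` below.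
      let P : (ι → n) → MvPolynomial n K := fun i =>
        quad w * C (pairing w s t i) - lin w s i * lin w t i
      have hP : ∀ i, (P i).IsHomogeneous 2 := fun i =>
        ((isHomogeneous_quad w).mul (isHomogeneous_C n _)).sub
          ((isHomogeneous_lin w s i).mul (isHomogeneous_lin w t i))
      refine ⟨(w e)⁻¹ • (P * G), Submodule.smul_mem _ _ ?_, fun i => ?_, fun i => ?_⟩
      · convert sub_mem (quad_mul_mem (pair_mul_mem hs ht hst hG))
          (lin_mul_mem hs' (lin_mul_mem ht hG)) using 1
        funext i
        simp only [P, Pi.mul_apply, Pi.sub_apply]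
        ring
      · rw [hcard, Pi.smul_apply, smul_eq_C_mul]
        simpa using (isHomogeneous_C n (w e)⁻¹).mul ((hP i).mul (hh i))
      · rw [hcard, Pi.smul_apply, coeff_smul, Pi.mul_apply, coeff_single_mul e (hP i) (hh i), hc,
          matchTensor_insert _ hs h, Pi.mul_apply, smul_eq_mul, ← mul_assoc]
        congr 1
        have h2 := coeff_single_mul e (isHomogeneous_lin w s i) (isHomogeneous_lin w t i)
        rw [coeff_sub, mul_comm (quad w), coeff_C_mul, coeff_single_quad, h2,
          coeff_single_lin, coeff_single_lin]
        simp only [pairing, update_apply]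
        by_cases h1 : i s = i t
        · by_cases h3 : i t = e
          · simp [h1, h3]
          · simp [h1, h3]; field_simp
        · by_cases h3 : i t = e
          · have h4 : i s ≠ e := fun h4 => h1 (h4.trans h3.symm)
            simp [h1, h4]
          · simp [h1, h3]
  | zero => exact ⟨0, zero_mem _, fun i => isHomogeneous_zero _ _ _, fun i => by simp⟩
  | add g h _ _ hg hh =>
    obtain ⟨G, hG, hG1, hG2⟩ := hg
    obtain ⟨H, hH, hH1, hH2⟩ := hh
    exact ⟨G + H, add_mem hG hH, fun i => (hG1 i).add (hH1 i), fun i => by simp [hG2, hH2]⟩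
  | smul c g _ hg =>
    obtain ⟨G, hG, hG1, hG2⟩ := hg
    refine ⟨c • G, Submodule.smul_mem _ _ hG, fun i => ?_, fun i => by simp [hG2]⟩
    rw [Pi.smul_apply, smul_eq_C_mul]
    simpa using (isHomogeneous_C n c).mul (hG1 i)

theorem exists_lift_union {w : n → K} {e : n} (he : w e ≠ 0) {S : Finset ι} {g : (ι → n) → K}
    (hg : g ∈ matchSpan (update w e 0) S) (T : Finset ι) (hT : Disjoint T S) :
    ∃ G ∈ genSpan w (T ∪ S), (∀ i, (G i).IsHomogeneous (T ∪ S).card) ∧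
      ∀ i, coeff (Finsupp.single e (T ∪ S).card) (G i) =
        (if ∀ s ∈ T, i s = e then 1 else 0) * g i := by
  induction T using Finset.induction_on with
  | empty => simpa using exists_lift he hg
  | insert s T hs ih =>
    rw [disjoint_insert_left] at hT
    obtain ⟨G, hG, hh, hc⟩ := ih hT.2
    have hs' : s ∉ T ∪ S := by simp [hs, hT.1]
    rw [insert_union, card_insert_of_notMem hs', add_comm]
    -- At `x = u_e` the normalised linear form is the indicator of `i s = e`.
    refine ⟨(w e)⁻¹ • fun i => lin w s i * G i, Submodule.smul_mem _ _ (lin_mul_mem hs' hG),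
      fun i => ?_, fun i => ?_⟩
    · rw [Pi.smul_apply, smul_eq_C_mul]
      simpa using (isHomogeneous_C n (w e)⁻¹).mul ((isHomogeneous_lin w s i).mul (hh i))
    · rw [Pi.smul_apply, coeff_smul, coeff_single_mul e (isHomogeneous_lin w s i) (hh i), hc,
        coeff_single_lin]
      by_cases h : i s = e
      · simp [h, he]
      · simp [h]

/-! ### The first fundamental theorem -/

/-- Tensors invariant under all infinitesimal rotations and under all reflections in basis vectors,
for the form with weights `w`. -/
structure IsOrthInv (w : n → K) (S : Finset ι) (f : (ι → n) → K) : Prop where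
  inv : IsRotInv w 0 S f
  supp : ∀ i, (∃ s ∈ S, w (i s) = 0) → f i = 0
  even : ∀ i a, Odd (S.filter fun s => i s = a).card → f i = 0

theorem IsOrthInv.eq_zero_of_odd {w : n → K} {S : Finset ι} {f : (ι → n) → K}
    (hf : IsOrthInv w S f) (hS : Odd S.card) : f = 0 := by
  funext i
  by_contra h
  have h1 : ∀ a, ¬ Odd (S.filter fun s => i s = a).card := fun a ha => h (hf.even i a ha)
  have h2 := card_eq_sum_card_fiberwise (s := S) (t := univ) (f := i) (by simp [Set.MapsTo])
  refine Nat.not_even_iff_odd.2 hS ?_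
  rw [h2]
  exact even_sum _ fun a _ => Nat.not_odd_iff_even.1 (h1 a)

/-- The tensor in the slots `R` obtained by inserting `u_e` in the slots `T` and restricting the
other slots to the orthogonal complement of `u_e`. -/
def restrict (e : n) (T R : Finset ι) (f : (ι → n) → K) (i : ι → n) : K :=
  if ∀ s ∈ R, i s ≠ e then f (fun s => if s ∈ T then e else i s) else 0

theorem IsOrthInv.restrict {w : n → K} {T R : Finset ι} {f : (ι → n) → K}
    (hf : IsOrthInv w (T ∪ R) f) (hTR : Disjoint T R) (e : n) :
    IsOrthInv (update w e 0) R (restrict e T R f) where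
  inv := by
    refine ⟨fun i j hij => ?_, fun a b i => ?_⟩
    · have h1 : (∀ s ∈ R, i s ≠ e) ↔ ∀ s ∈ R, j s ≠ e :=
        forall₂_congr fun s hs => by rw [hij s hs]
      simp only [OrthInv.restrict, h1]
      refine if_congr Iff.rfl (hf.inv.dep _ _ fun s hs => ?_) rfl
      by_cases h : s ∈ T
      · simp [h]
      · simp [h, hij s ((mem_union.1 hs).resolve_left h)]
    · rw [Pi.zero_apply, Pi.zero_apply, Derivation.zero_apply, add_zero]
      have hu : ∀ s ∈ R, ∀ a : n, (fun t => if t ∈ T then e else update i s a t) =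
          update (fun t => if t ∈ T then e else i t) s a := by
        intro s hs a
        have := disjoint_right.1 hTR hs
        funext t
        by_cases ht : t = s
        · subst ht; simp [this]
        · simp [ht]
      -- Rotations involving `u_e` act by zero: the restricted tensor vanishes when `u_e` enters a
      -- slot of `R`, and the new weight of `e` is zero. The other rotations fix `u_e`, so the slots
      -- in `T` do not contribute.
      by_cases ha : a = e
      · subst ha
        refine sum_eq_zero fun s hs => ?_
        have : OrthInv.restrict a T R f (update i s a) = 0 :=
          if_neg fun h => h s hs (by simp)
        simp [this]
      by_cases hb : b = e
      · subst hb
        refine sum_eq_zero fun s hs => ?_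
        have : OrthInv.restrict b T R f (update i s b) = 0 :=
          if_neg fun h => h s hs (by simp)
        simp [this]
      by_cases hi : ∀ s ∈ R, i s ≠ e
      · have h0 := hf.inv.rot_eq a b (fun s => if s ∈ T then e else i s)
        rw [Pi.zero_apply, Pi.zero_apply, Derivation.zero_apply, add_zero, rot,
          sum_union hTR, sum_eq_zero, zero_add] at h0
        · rw [← h0]
          refine sum_congr rfl fun s hs => ?_
          have hsT := disjoint_right.1 hTR hs
          have hr : ∀ c : n, c ≠ e → OrthInv.restrict e T R f (update i s c) =
              f (update (fun t => if t ∈ T then e else i t) s c) := by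
            intro c hc
            rw [OrthInv.restrict, if_pos, hu s hs]
            intro t ht
            by_cases hts : t = s
            · subst hts; simpa using hc
            · simpa [hts] using hi t ht
          simp [hr a ha, hr b hb, hsT, update_of_ne ha, update_of_ne hb]
        · intro s hs
          simp [hs, Ne.symm ha, Ne.symm hb]
      · push Not at hi
        obtain ⟨t, ht, hte⟩ := hi
        refine sum_eq_zero fun s hs => ?_
        have hr : i s ≠ e → ∀ c, OrthInv.restrict e T R f (update i s c) = 0 := by
          intro hs c
          refine if_neg fun h => h t ht ?_
          rw [update_of_ne, hte]
          rintro rfl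
          exact hs hte
        by_cases his : i s = e
        · simp [his, Ne.symm ha, Ne.symm hb]
        · simp [hr his]
  supp := by
    rintro i ⟨s, hs, h⟩
    by_cases hi : i s = e
    · exact if_neg fun h => h s hs hi
    · rw [update_of_ne hi] at h
      rw [OrthInv.restrict, hf.supp, ite_self]
      refine ⟨s, mem_union_right _ hs, ?_⟩
      simpa [disjoint_right.1 hTR hs] using h
  even := by
    intro i a ha
    rw [OrthInv.restrict]
    split_ifs with h
    · refine hf.even _ a ?_
      convert ha using 2
      have hae : a ≠ e := by
        rintro rfl
        rw [filter_eq_empty_iff.2 (fun s hs => h s hs)] at ha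
        simp at ha
      ext s
      simp only [mem_filter, mem_union]
      by_cases hs : s ∈ T
      · simp [hs, Ne.symm hae, disjoint_left.1 hTR hs]
      · simp [hs]
    · rfl

/-! ### Polarisation in one slot -/

/-- The tensor `f`, with a vector `x` with indeterminate coordinates inserted in the slot `s`. -/
def polar (s : ι) (f : (ι → n) → K) (i : ι → n) : MvPolynomial n K :=
  ∑ c, C (f (update i s c)) * X c

theorem pderiv_polar (s : ι) (f : (ι → n) → K) (i : ι → n) (a : n) :
    pderiv a (polar s f i) = C (f (update i s a)) := by
  rw [polar, map_sum, sum_eq_single a]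
  · rw [pderiv_C_mul, pderiv_X_self, mul_one]
  · intro b _ hb
    rw [pderiv_C_mul, pderiv_X_of_ne hb, mul_zero]
  · simp

theorem isHomogeneous_polar (s : ι) (f : (ι → n) → K) (i : ι → n) :
    (polar s f i).IsHomogeneous 1 :=
  IsHomogeneous.sum _ _ _ fun c _ => by
    simpa using (isHomogeneous_C n (f (update i s c))).mul (isHomogeneous_X K c)

theorem coeff_single_polar (s : ι) (f : (ι → n) → K) (i : ι → n) (e : n) :
    coeff (Finsupp.single e 1) (polar s f i) = f (update i s e) := by
  rw [polar, coeff_sum, sum_eq_single e]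
  · simp
  · intro b _ hb
    simp [coeff_C_mul, hb]
  · simp

/-- Rotating the vector in slot `s` becomes the derivation `rotDer` in the coordinates of `x`; the
remaining slots keep their action. -/
theorem IsRotInv.polar {w : n → K} {S : Finset ι} {s : ι} (hs : s ∉ S) {f : (ι → n) → K}
    (hf : IsRotInv w 0 (insert s S) f) : IsRotInv w (rotDer w) S (polar s f) where
  dep i j hij := by
    rw [OrthInv.polar, OrthInv.polar]
    refine sum_congr rfl fun c _ => ?_
    rw [hf.dep (update i s c) (update j s c)]
    intro t ht
    by_cases hts : t = s
    · subst hts; simp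
    · rw [update_of_ne hts, update_of_ne hts, hij t ((mem_insert.1 ht).resolve_left hts)]
  rot_eq a b i := by
    have h1 : rot w S a b (OrthInv.polar s f) i =
        ∑ c, C (rot w S a b f (update i s c)) * X c := by
      simp only [rot, map_sum, sum_mul, OrthInv.polar]
      rw [sum_comm]
      refine sum_congr rfl fun t ht => ?_
      have hts : t ≠ s := ne_of_mem_of_not_mem ht hs
      have hu : ∀ c d, update (update i t c) s d = update (update i s d) t c :=
        fun c d => update_comm hts _ _ _
      simp only [hu, update_of_ne hts, smul_eq_C_mul, map_sub, sub_mul, sum_sub_distrib]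
      split_ifs <;> simp [mul_sum, mul_assoc]
    have h2 : ∀ c, rot w S a b f (update i s c) =
        (if c = a then w a * f (update i s b) else 0) -
          if c = b then w b * f (update i s a) else 0 := by
      intro c
      have h0 := hf.rot_eq a b (update i s c)
      rw [Pi.zero_apply, Pi.zero_apply, Derivation.zero_apply, add_zero, rot, sum_insert hs,
        ← rot] at h0
      simp only [update_self, update_idem, smul_eq_mul] at h0
      linear_combination h0
    rw [h1, rotDer_apply, pderiv_polar, pderiv_polar]
    simp only [h2, map_sub, sub_mul, sum_sub_distrib, apply_ite C, ite_mul, map_zero, zero_mul,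
      sum_ite_eq', mem_univ, if_true, map_mul]
    ring

theorem lap_polar (w : n → K) (s : ι) (f : (ι → n) → K) (i : ι → n) :
    lap w (polar s f i) = 0 := by
  rw [lap_apply]
  refine sum_eq_zero fun a _ => ?_
  rw [pderiv_polar, pderiv_C, mul_zero]

theorem euler_polar {w : n → K} {s : ι} {f : (ι → n) → K} {i : ι → n}
    (hf : ∀ c, w c = 0 → f (update i s c) = 0) : euler w (polar s f i) = polar s f i := by
  rw [euler_apply]
  conv_rhs => rw [polar]
  refine sum_congr rfl fun c _ => ?_
  rw [pderiv_polar]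
  by_cases hc : w c = 0
  · simp [hf c hc]
  · rw [mul_inv_cancel₀ hc, map_one]; ring

/-! ### Cancelling powers of the quadratic form -/

theorem euler_quad_pow_mul (w : n → K) {p : MvPolynomial n K} (hp : euler w p = p) (j : ℕ) :
    euler w (quad w ^ j * p) = C (2 * j + 1 : K) * (quad w ^ j * p) := by
  induction j with
  | zero => simp [hp]
  | succ j ih =>
    rw [pow_succ', mul_assoc, Derivation.leibniz, ih, euler_quad, smul_eq_mul, smul_eq_mul]
    simp only [Nat.cast_add, Nat.cast_one, map_add, map_mul, map_ofNat, map_one]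
    ring

theorem lap_quad_pow_mul (w : n → K) {p : MvPolynomial n K} (hp : euler w p = p)
    (hp' : lap w p = 0) (j : ℕ) : lap w (quad w ^ (j + 1) * p) =
      C (2 * (j + 1) * (2 * j + 2 + ∑ a, w a * (w a)⁻¹)) * (quad w ^ j * p) := by
  induction j with
  | zero =>
    rw [zero_add, pow_one, lap_quad_mul, hp, hp']
    simp only [Nat.cast_zero, map_add, map_mul, map_ofNat, map_one, map_zero]
    ring
  | succ j ih =>
    rw [pow_succ', mul_assoc, lap_quad_mul, ih, euler_quad_pow_mul w hp]
    simp only [Nat.cast_add, Nat.cast_one, map_add, map_mul, map_ofNat, map_one]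
    ring

theorem exists_sum_mul_inv_eq_cast (w : n → K) : ∃ k : ℕ, ∑ a, w a * (w a)⁻¹ = k := by
  classical
  refine ⟨∑ a, if w a = 0 then 0 else 1, ?_⟩
  rw [Nat.cast_sum]
  refine sum_congr rfl fun a _ => ?_
  by_cases h : w a = 0 <;> simp [h]

/-- On a harmonic function of degree one, the Laplacian undoes one multiplication by `quad` up to a
positive integer, and it preserves `genSpan`. Characteristic zero makes that integer invertible. -/
theorem mem_genSpan_of_quad_pow_mul_mem [CharZero K] {w : n → K} {S : Finset ι}
    {g : (ι → n) → MvPolynomial n K} (h1 : ∀ i, euler w (g i) = g i) (h2 : ∀ i, lap w (g i) = 0)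
    (j : ℕ) (h : (fun i => quad w ^ j * g i) ∈ genSpan w S) : g ∈ genSpan w S := by
  induction j with
  | zero => simpa using h
  | succ j ih =>
    refine ih ?_
    have h3 := lap_mem h
    obtain ⟨k, hk⟩ := exists_sum_mul_inv_eq_cast w
    simp only [lap_quad_pow_mul w (h1 _) (h2 _), hk] at h3
    have hc : (2 * (j + 1) * (2 * j + 2 + k) : K) ≠ 0 := by
      norm_cast
      positivity
    refine (Submodule.smul_mem_iff _ hc).1 ?_
    convert h3 using 1
    funext i
    rw [Pi.smul_apply, smul_eq_C_mul]

/-! ### Returning to scalar tensors by expansion at the origin -/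

theorem constantCoeff_quad (w : n → K) : constantCoeff (quad w) = 0 := by
  simp [quad]

theorem constantCoeff_lin (w : n → K) (s : ι) (i : ι → n) : constantCoeff (lin w s i) = 0 := by
  simp [lin]

theorem constantCoeff_mem {w : n → K} {S : Finset ι} {g : (ι → n) → MvPolynomial n K}
    (hg : g ∈ genSpan w S) : (fun i => constantCoeff (g i)) ∈ matchSpan w S := by
  let φ : ((ι → n) → MvPolynomial n K) →ₗ[K] ((ι → n) → K) :=
    { toFun g i := constantCoeff (g i)
      map_add' g h := by funext i; simp
      map_smul' c g := by funext i; simp [smul_eq_C_mul] }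
  refine (Submodule.span_le (p := (matchSpan w S).comap φ)).2 (fun g hg' => ?_) hg
  clear hg
  change (fun i => constantCoeff (g i)) ∈ matchSpan w S
  induction hg' with
  | one =>
    convert one_mem_matchSpan w using 1
    funext i
    simp
  | @quad S g h ih =>
    convert zero_mem (matchSpan w S)
    simp only []
    rw [map_mul, constantCoeff_quad, zero_mul, Pi.zero_apply]
  | @lin S g s hs h ih =>
    convert zero_mem (matchSpan w (insert s S))
    simp only []
    rw [map_mul, constantCoeff_lin, zero_mul, Pi.zero_apply]
  | pair hs ht hst h ih =>
    convert pairing_mul_mem_matchSpan w hs ht hst ih using 1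
    funext i
    simp

/-- Only products with exactly one linear form, and no factor `quad`, have a first-order term at the
origin. Differentiating along `u_{i_s}` pairs that form's slot with `s`. -/
theorem IsGen.constantCoeff_pderiv_mem {w : n → K} {S : Finset ι} {s : ι} (hs : s ∉ S)
    {g : (ι → n) → MvPolynomial n K} (hg : IsGen w S g) :
    (fun i => constantCoeff (pderiv (i s) (g i))) ∈ matchSpan w (insert s S) := by
  induction hg with
  | one => convert zero_mem (matchSpan w (insert s (∅ : Finset ι))); simp
  | @quad S g h ih =>
    convert zero_mem (matchSpan w (insert s S))
    simp only [pderiv_mul, pderiv_quad, map_add, map_mul, constantCoeff_quad, constantCoeff_X,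
      mul_zero, zero_mul, add_zero, Pi.zero_apply]
  | @lin S g t ht h ih =>
    simp only [mem_insert, not_or] at hs
    convert pairing_mul_mem_matchSpan w hs.2 ht hs.1 (constantCoeff_mem h.mem) using 1
    funext i
    rw [pderiv_mul, pderiv_lin, Pi.mul_apply, pairing, map_add, map_mul, map_mul,
      constantCoeff_lin, zero_mul, add_zero]
    by_cases hi : i s = i t
    · rw [if_pos hi, if_pos hi.symm, constantCoeff_C]
    · rw [if_neg hi, if_neg (Ne.symm hi), map_zero]
  | @pair S g t u ht hu htu h ih =>
    simp only [mem_insert, not_or] at hs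
    have h2 := pairing_mul_mem_matchSpan w (s := t) (t := u) (by simp [ht, Ne.symm hs.1])
      (by simp [hu, Ne.symm hs.2.1]) htu (ih hs.2.2)
    rw [insert_comm u s, insert_comm t s] at h2
    convert h2 using 1
    funext i
    rw [pderiv_C_mul, map_mul, constantCoeff_C, Pi.mul_apply]

theorem constantCoeff_pderiv_mem {w : n → K} {S : Finset ι} {s : ι} (hs : s ∉ S)
    {g : (ι → n) → MvPolynomial n K} (hg : g ∈ genSpan w S) :
    (fun i => constantCoeff (pderiv (i s) (g i))) ∈ matchSpan w (insert s S) := by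
  induction hg using Submodule.span_induction with
  | mem g hg => exact IsGen.constantCoeff_pderiv_mem hs hg
  | zero =>
    convert zero_mem (matchSpan w (insert s S))
    simp
  | add g h _ _ hg hh =>
    convert add_mem hg hh using 1
    funext i
    simp
  | smul c g _ hg =>
    convert Submodule.smul_mem _ c hg using 1
    funext i
    simp [smul_eq_C_mul]

/-- The values at `x = u_e` of the polarisation of an invariant tensor are those of an invariant
function, provided that the first fundamental theorem holds for the complement of `u_e`. -/
theorem exists_mem_genSpan_coeff_eq {w : n → K} {e : n} (he : w e ≠ 0) {S : Finset ι} {s : ι}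
    (hs : s ∉ S) {f : (ι → n) → K} (hf : IsOrthInv w (insert s S) f)
    (ih : ∀ (R : Finset ι) (g : (ι → n) → K), IsOrthInv (update w e 0) R g →
      g ∈ matchSpan (update w e 0) R) :
    ∃ G ∈ genSpan w S, (∀ i, (G i).IsHomogeneous S.card) ∧
      ∀ i, coeff (Finsupp.single e S.card) (G i) = f (update i s e) := by
  have h : ∀ T, T ⊆ S → ∃ G ∈ genSpan w S, (∀ i, (G i).IsHomogeneous S.card) ∧
      ∀ i, coeff (Finsupp.single e S.card) (G i) =
        (if ∀ t ∈ T, i t = e then 1 else 0) * restrict e (insert s T) (S \ T) f i := by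
    intro T hT
    have h1 : insert s T ∪ (S \ T) = insert s S := by
      rw [insert_union, union_sdiff_of_subset hT]
    have h2 : Disjoint (insert s T) (S \ T) := by
      rw [disjoint_insert_left]
      exact ⟨fun h => hs (mem_sdiff.1 h).1, disjoint_sdiff⟩
    have h3 := exists_lift_union he (ih _ _ ((h1 ▸ hf).restrict h2 e)) T disjoint_sdiff
    rwa [union_sdiff_of_subset hT] at h3
  choose! G hG hh hc using h
  refine ⟨∑ T ∈ S.powerset, G T, sum_mem fun T hT => hG T (mem_powerset.1 hT), fun i => ?_,
    fun i => ?_⟩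
  · rw [Finset.sum_apply]
    exact IsHomogeneous.sum _ _ _ fun T hT => hh T (mem_powerset.1 hT) i
  · rw [Finset.sum_apply, coeff_sum, sum_congr rfl fun T hT => hc T (mem_powerset.1 hT) i,
      -- The summand of `T` requires `u_e` in all slots of `T` and in none of `S \ T`, so exactly
      -- one subset contributes.
      sum_eq_single (S.filter fun t => i t = e)]
    · rw [if_pos fun t ht => (mem_filter.1 ht).2, one_mul, restrict, if_pos]
      · congr 1
        funext t
        by_cases hts : t = s
        · subst hts; simp
        · by_cases ht : t ∈ S <;> by_cases hte : i t = e <;> simp [hts, ht, hte]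
      · intro t ht
        simp only [mem_sdiff, mem_filter, not_and] at ht
        exact ht.2 ht.1
    · intro T hT hne
      by_cases hTe : ∀ t ∈ T, i t = e
      · suffices hn : ¬ ∀ t ∈ S \ T, i t ≠ e by rw [restrict, if_neg hn, mul_zero]
        intro h
        refine hne (Subset.antisymm (fun t ht => mem_filter.2 ⟨mem_powerset.1 hT ht, hTe t ht⟩)
          fun t ht => ?_)
        by_contra hn
        exact h t (mem_sdiff.2 ⟨(mem_filter.1 ht).1, hn⟩) (mem_filter.1 ht).2
      · rw [if_neg hTe, zero_mul]
    · intro h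
      exact absurd (mem_powerset.2 (filter_subset _ _)) h

/-- The first fundamental theorem of invariant theory for the orthogonal group: the invariant
tensors are the linear combinations of matching tensors. -/
theorem IsOrthInv.mem_matchSpan [CharZero K] {w : n → K} {S : Finset ι} {f : (ι → n) → K}
    (hf : IsOrthInv w S f) : f ∈ matchSpan w S := by
  -- The induction runs over a set that merely contains the indices of nonzero weight; the index
  -- type stays fixed while weights are set to zero.
  obtain ⟨A, hA⟩ : ∃ A : Finset n, ∀ a, w a ≠ 0 → a ∈ A := ⟨univ, fun a _ => mem_univ a⟩
  induction A using Finset.induction_on generalizing w S f with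
  | empty =>
    rcases S.eq_empty_or_nonempty with rfl | ⟨s, hs⟩
    · rcases isEmpty_or_nonempty (ι → n) with h | ⟨⟨j⟩⟩
      · convert zero_mem (matchSpan w (∅ : Finset ι))
      · convert Submodule.smul_mem _ (f j) (one_mem_matchSpan (ι := ι) w)
        funext i
        simp [hf.inv.dep i j (by simp)]
    · convert zero_mem (matchSpan w S)
      funext i
      refine hf.supp i ⟨s, hs, ?_⟩
      by_contra h
      simpa using hA _ h
  | insert e A heA ih =>
    have hA' : ∀ a, update w e 0 a ≠ 0 → a ∈ A := by
      intro a ha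
      by_cases hae : a = e
      · subst hae; simp at ha
      · rw [update_of_ne hae] at ha
        exact (mem_insert.1 (hA a ha)).resolve_left hae
    by_cases he : w e = 0
    · rw [update_eq_self_iff.2 he.symm] at hA'
      exact ih hf hA'
    rcases S.eq_empty_or_nonempty with rfl | ⟨s, hs⟩
    · rcases isEmpty_or_nonempty (ι → n) with h | ⟨⟨j⟩⟩
      · convert zero_mem (matchSpan w (∅ : Finset ι))
      · convert Submodule.smul_mem _ (f j) (one_mem_matchSpan (ι := ι) w)
        funext i
        simp [hf.inv.dep i j (by simp)]
    obtain ⟨T, hsT, rfl⟩ : ∃ T, s ∉ T ∧ insert s T = S :=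
      ⟨S.erase s, notMem_erase s S, insert_erase hs⟩
    by_cases hodd : Odd (insert s T).card
    · rw [hf.eq_zero_of_odd hodd]; exact zero_mem _
    -- The lift `G` has degree `T.card` in `x` and the polarisation has degree one, so the factor
    -- `quad w ^ p` is what makes the degrees agree.
    obtain ⟨p, hp⟩ : ∃ p, T.card = 2 * p + 1 := by
      rw [card_insert_of_notMem hsT, Nat.odd_add_one, not_not] at hodd
      exact hodd
    obtain ⟨G, hG, hGh, hGc⟩ := exists_mem_genSpan_coeff_eq he hsT hf
      fun R g hg => ih hg hA'
    rw [hp] at hGh hGc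
    have hL : IsRotInv w (rotDer w) T fun i => quad w ^ p * polar s f i := by
      have h0 := hf.inv.polar hsT
      clear hp hGh hGc hodd
      induction p with
      | zero => simpa using h0
      | succ p ihp =>
        have := (isRotInv_quad w).mul ihp (by simp)
        rw [empty_union] at this
        convert this using 1
        funext i
        simp [pow_succ', mul_assoc]
    have hqp : (quad w ^ p).IsHomogeneous (2 * p) := (isHomogeneous_quad w).pow p
    have hqc : ∀ q : ℕ, coeff (Finsupp.single e (2 * q)) (quad w ^ q) = w e ^ q := by
      intro q
      induction q with
      | zero => simp
      | succ q ihq =>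
        rw [pow_succ, pow_succ, mul_add, mul_one, coeff_single_mul e
          ((isHomogeneous_quad w).pow q) (isHomogeneous_quad w), ihq, coeff_single_quad]
    -- Both functions are invariant, and `quad w ^ p` takes the value `w e ^ p` at `u_e`, so
    -- rigidity identifies them.
    have hD := eq_zero_of_coeff_single (N := 2 * p + 1) he
      (D := (fun i => quad w ^ p * polar s f i) - w e ^ p • G)
      ((rotInvSubmodule w (rotDer w) T).sub_mem hL
        (Submodule.smul_mem _ _ (genSpan_le_rotInvSubmodule w T hG)))
      (fun i => by
        rw [Pi.sub_apply, Pi.smul_apply, smul_eq_C_mul]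
        refine (hqp.mul (isHomogeneous_polar s f i)).sub ?_
        simpa using (isHomogeneous_C n (w e ^ p)).mul (hGh i))
      (fun i => by
        rw [Pi.sub_apply, Pi.smul_apply, coeff_sub, coeff_smul,
          coeff_single_mul e hqp (isHomogeneous_polar s f i), hqc, coeff_single_polar, hGc,
          smul_eq_mul, sub_self])
    have hmem : (fun i => quad w ^ p * polar s f i) ∈ genSpan w T := by
      rw [sub_eq_zero.1 hD]
      exact Submodule.smul_mem _ _ hG
    have hmem' := constantCoeff_pderiv_mem hsT (mem_genSpan_of_quad_pow_mul_mem
      (fun i => euler_polar fun c hc => hf.supp _ ⟨s, mem_insert_self s T, by simpa using hc⟩)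
      (fun i => lap_polar w s f i) p hmem)
    simpa [pderiv_polar] using hmem'

end

open Finset Function

noncomputable section

variable {K n ι : Type*} [Field K] [Fintype n] [DecidableEq n] [DecidableEq ι]

/-! ### Parity -/

/-- Commuting involutions have simultaneous eigenvalues `±1`, so the eigenvalues of their sum have
the parity of `S.card`. In the induction, `v + σ t v` and `v - σ t v` have eigenvalues `c - 1` and
`c + 1` for the remaining sum, and both vanish. -/
theorem eq_zero_of_sum_involutions [CharZero K] {α M : Type*} [DecidableEq α] [AddCommGroup M]
    [Module K M] (σ : α → Module.End K M) (hcomm : ∀ s t, Commute (σ s) (σ t))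
    (hinv : ∀ s, σ s * σ s = 1) (S : Finset α) (c : ℤ) (hc : Odd (c - S.card)) (v : M)
    (hv : ∑ s ∈ S, σ s v = (c : K) • v) : v = 0 := by
  induction S using Finset.induction_on generalizing c v with
  | empty =>
    have : (c : K) ≠ 0 := by
      rw [Int.cast_ne_zero]
      rintro rfl
      simp at hc
    simpa [this, eq_comm] using hv
  | insert t S ht ih =>
    rw [sum_insert ht] at hv
    rw [card_insert_of_notMem ht] at hc
    push_cast at hc
    have hinv' : ∀ x, σ t (σ t x) = x := fun x => LinearMap.congr_fun (hinv t) x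
    have hσ : ∑ s ∈ S, σ s (σ t v) = (c : K) • σ t v - v := by
      have : ∑ s ∈ S, σ s (σ t v) = σ t (∑ s ∈ S, σ s v) := by
        rw [map_sum]
        exact sum_congr rfl fun s _ => LinearMap.congr_fun (hcomm s t) v
      rw [this, eq_sub_of_add_eq' hv, map_sub, map_smul, hinv']
    have h1 : v + σ t v = 0 := by
      refine ih (c - 1) ?_ _ ?_
      · rwa [sub_sub, add_comm 1]
      · simp only [map_add, sum_add_distrib]
        rw [hσ, eq_sub_of_add_eq' hv]
        push_cast
        module
    have h2 : v - σ t v = 0 := by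
      refine ih (c + 1) ?_ _ ?_
      · have : c + 1 - (S.card : ℤ) = c - (S.card + 1) + 2 * 1 := by ring
        rw [this]
        exact hc.add_even (even_two_mul 1)
      · simp only [map_sub, sum_sub_distrib]
        rw [hσ, eq_sub_of_add_eq' hv]
        push_cast
        module
    have h3 : (2 : K) • v = 0 := by
      rw [two_smul, ← add_zero (0 : M)]
      nth_rw 2 [← h2]
      rw [← h1]
      abel
    simpa using h3

/-- Negation of the coordinate `s` of the cube. -/
def flip (K : Type*) [Field K] (s : ι) : Module.End K ((ι → Bool) → K) :=
  LinearMap.funLeft K K fun χ => update χ s (!χ s)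

theorem flip_apply (s : ι) (g : (ι → Bool) → K) (χ : ι → Bool) :
    flip K s g χ = g (update χ s (!χ s)) := rfl

theorem flip_commute (s t : ι) : Commute (flip K s) (flip K t) := by
  by_cases hst : s = t
  · rw [hst]
  · refine LinearMap.ext fun g => funext fun χ => ?_
    rw [Module.End.mul_apply, Module.End.mul_apply, flip_apply, flip_apply, flip_apply, flip_apply,
      update_of_ne hst, update_of_ne (Ne.symm hst), update_comm hst]

theorem flip_mul_self (s : ι) : flip K s * flip K s = 1 := by
  refine LinearMap.ext fun g => funext fun χ => ?_
  rw [Module.End.mul_apply, flip_apply, flip_apply]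
  simp

/-- A rotation-invariant tensor is supported on the index vectors containing the two vectors of a
hyperbolic plane an even number of times. -/
theorem IsRotInv.eq_zero_of_odd_add [CharZero K] {w : n → K} {S : Finset ι} {f : (ι → n) → K}
    (hf : IsRotInv w 0 S f) {a b : n} (ha : w a ≠ 0) (hab : w a + w b = 0) {i : ι → n}
    (hi : Odd ((S.filter fun s => i s = a).card + (S.filter fun s => i s = b).card)) :
    f i = 0 := by
  have hne : a ≠ b := by
    rintro rfl
    exact ha (by simpa using hab)
  have hb : w b ≠ 0 := fun h => ha (by simpa [h] using hab)
  let T := S.filter fun s => i s = a ∨ i s = b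
  have hT : Odd T.card := by
    rwa [← card_union_of_disjoint, ← filter_or] at hi
    exact disjoint_filter.2 fun s _ h1 h2 => hne (h1.symm.trans h2)
  -- Varying the entries in `T` over `a` and `b` restricts `f` to a cube on which the rotation acts.
  let J : (ι → Bool) → ι → n := fun χ s => if s ∈ T then (if χ s then a else b) else i s
  have hJ : ∀ χ, ∀ s ∈ T, ∀ c, update (J χ) s (if c then a else b) = J (update χ s c) := by
    intro χ s hs c
    funext t
    by_cases hts : t = s
    · subst hts; simp [J, hs]
    · simp [J, hts]
  have key := eq_zero_of_sum_involutions (K := K) (flip K) flip_commute flip_mul_self T 0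
    (by rw [zero_sub]; simpa using hT) (fun χ => f (J χ)) (by
      funext χ
      rw [Finset.sum_apply, Int.cast_zero, zero_smul, Pi.zero_apply]
      have h0 := hf.rot_eq a b (J χ)
      rw [Pi.zero_apply, Pi.zero_apply, Derivation.zero_apply, add_zero, rot,
        ← sum_filter_add_sum_filter_not S (fun s => i s = a ∨ i s = b),
        sum_eq_zero (s := S.filter fun s => ¬ (i s = a ∨ i s = b)),
        add_zero] at h0
      · have h1 : w b * ∑ s ∈ T, flip K s (fun χ => f (J χ)) χ = 0 := by
          rw [← h0, mul_sum]
          refine sum_congr rfl fun s hs => ?_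
          have e1 : J χ s = if χ s then a else b := if_pos hs
          have e2 := hJ χ s hs true
          have e3 := hJ χ s hs false
          simp only [if_true, Bool.false_eq_true, if_false] at e2 e3
          rw [flip_apply, e1, e2, e3]
          cases hc : χ s
          · simp [hne.symm]
          · simp [hne, eq_neg_of_add_eq_zero_left hab]
        exact (mul_eq_zero.1 h1).resolve_left hb
      · intro s hs
        rw [mem_filter, not_or] at hs
        have : J χ s = i s := if_neg fun h => by
          have := (mem_filter.1 h).2
          tauto
        rw [this, if_neg hs.2.1, if_neg hs.2.2, sub_zero])
  have h1 := congrFun key fun s => decide (i s = a)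
  simp only [Pi.zero_apply] at h1
  rw [← h1]
  congr 1
  funext s
  by_cases hs : s ∈ T
  · rcases (mem_filter.1 hs).2 with h | h
    · simp [J, hs, h]
    · simp [J, hs, h, hne.symm]
  · simp [J, hs]

/-! ### Linear independence of the matching tensors -/

theorem IsMatching.not_isDiag {S : Finset ι} {M : Finset (Sym2 ι)} (h : IsMatching S M) :
    ∀ z ∈ M, ¬ z.IsDiag := by
  induction h with
  | empty => simp
  | insert hs ht hst h ih =>
    intro z hz
    rcases mem_insert.1 hz with rfl | hz
    · simpa using hst
    · exact ih z hz

theorem IsMatching.exists_mem {S : Finset ι} {M : Finset (Sym2 ι)} (h : IsMatching S M) :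
    ∀ s ∈ S, ∃ z ∈ M, s ∈ z := by
  induction h with
  | empty => simp
  | @insert S M s t hs ht hst h ih =>
    intro u hu
    rcases mem_insert.1 hu with rfl | hu
    · exact ⟨s(u, t), mem_insert_self _ _, by simp⟩
    rcases mem_insert.1 hu with rfl | hu
    · exact ⟨s(s, u), mem_insert_self _ _, by simp⟩
    · obtain ⟨z, hz, huz⟩ := ih u hu
      exact ⟨z, mem_insert_of_mem hz, huz⟩

theorem IsMatching.eq_of_mem {S : Finset ι} {M : Finset (Sym2 ι)} (h : IsMatching S M) :
    ∀ z ∈ M, ∀ z' ∈ M, ∀ s, s ∈ z → s ∈ z' → z = z' := by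
  induction h with
  | empty => simp
  | @insert S M s t hs ht hst h ih =>
    have key : ∀ z ∈ M, ∀ u, u ∈ s(s, t) → u ∈ z → False := by
      intro z hz u hu huz
      have := h.mem_of_mem z hz u huz
      rcases Sym2.mem_iff.1 hu with rfl | rfl <;> contradiction
    intro z hz z' hz' u hu hu'
    rcases mem_insert.1 hz with rfl | hz <;> rcases mem_insert.1 hz' with rfl | hz'
    · rfl
    · exact (key z' hz' u hu hu').elim
    · exact (key z hz u hu' hu).elim
    · exact ih z hz z' hz' u hu hu'

theorem IsMatching.two_mul_card {S : Finset ι} {M : Finset (Sym2 ι)} (h : IsMatching S M) :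
    2 * M.card = S.card := by
  induction h with
  | empty => simp
  | @insert S M s t hs ht hst h ih =>
    rw [card_insert_of_notMem fun hM => hs (h.mem_of_mem _ hM s (by simp)),
      card_insert_of_notMem (by simp [hs, hst]), card_insert_of_notMem ht]
    omega

/-- A perfect matching `M` is the only one whose tensor does not vanish on a suitable index
vector. -/
theorem IsMatching.exists_index [Fintype ι] {w : n → K} (hw : ∀ a, w a ≠ 0)
    (hcard : Fintype.card ι ≤ 2 * Fintype.card n) {M : Finset (Sym2 ι)}
    (hM : IsMatching univ M) : ∃ i : ι → n, matchTensor w M i ≠ 0 ∧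
      ∀ M', IsMatching univ M' → matchTensor w M' i ≠ 0 → M' = M := by
  have h2 := hM.two_mul_card
  rw [card_univ] at h2
  -- Give the pairs of `M` distinct labels. Two slots then carry the same index only if `M` pairs
  -- them or they coincide, so a matching with nonzero tensor is contained in `M`.
  obtain ⟨c⟩ : Nonempty (M ↪ n) := Embedding.nonempty_of_card_le (by
    rw [Fintype.card_coe]; omega)
  choose z hz hsz using fun s => hM.exists_mem s (mem_univ s)
  let i : ι → n := fun s => c ⟨z s, hz s⟩
  have hi : ∀ s t, i s = i t ↔ z s = z t := fun s t => by
    simp only [i, c.injective.eq_iff, Subtype.mk.injEq]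
  have hpair : ∀ s t, pairing w s t i ≠ 0 ↔ z s = z t := fun s t => by
    simp only [pairing, ← hi]
    split_ifs with h <;> simp [h, hw]
  refine ⟨i, prod_ne_zero_iff.2 fun y hy => ?_, fun M' hM' hne => ?_⟩
  · induction y using Sym2.ind with
    | _ s t =>
      refine (hpair s t).2 ?_
      rw [hM.eq_of_mem _ (hz s) _ hy s (hsz s) (by simp),
        hM.eq_of_mem _ (hz t) _ hy t (hsz t) (by simp)]
  · refine eq_of_subset_of_card_le (fun y hy => ?_) ?_
    · have hy0 := prod_ne_zero_iff.1 hne y hy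
      have hyd := hM'.not_isDiag y hy
      induction y using Sym2.ind with
      | _ s t =>
        have hst := (hpair s t).1 hy0
        have : z s = s(s, t) :=
          (Sym2.mem_and_mem_iff (by simpa using hyd)).1 ⟨hsz s, hst ▸ hsz t⟩
        rw [← this]
        exact hz s
    · have := hM'.two_mul_card
      rw [card_univ] at this
      omega

theorem linearIndependent_matchTensor [Fintype ι] {w : n → K} (hw : ∀ a, w a ≠ 0)
    (hcard : Fintype.card ι ≤ 2 * Fintype.card n) :
    LinearIndependent K fun M : {M : Finset (Sym2 ι) // IsMatching univ M} =>
      matchTensor w M.1 := by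
  classical
  rw [Fintype.linearIndependent_iff]
  intro c hc M
  obtain ⟨i, hi, hM⟩ := M.2.exists_index hw hcard
  have h := congrFun hc i
  rw [Finset.sum_apply, sum_eq_single M] at h
  · exact (mul_eq_zero.1 h).resolve_right hi
  · intro M' _ hne
    by_contra h0
    refine hne (Subtype.ext (hM M'.1 M'.2 fun h1 => h0 ?_))
    rw [Pi.smul_apply, h1, smul_zero]
  · simp

theorem finrank_matchSpan [Fintype ι] {w : n → K} (hw : ∀ a, w a ≠ 0)
    (hcard : Fintype.card ι ≤ 2 * Fintype.card n) :
    Module.finrank K (matchSpan w (univ : Finset ι)) =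
      Nat.card {M : Finset (Sym2 ι) // IsMatching univ M} := by
  classical
  rw [Nat.card_eq_fintype_card, ← finrank_span_eq_card (linearIndependent_matchTensor hw hcard),
    matchSpan, Set.image_eq_range]
  rfl

/-- Where a product of pairings is nonzero, paired slots carry equal indices, so every index occurs
an even number of times. -/
theorem eq_zero_of_mem_matchSpan_of_odd {w : n → K} {S : Finset ι} {f : (ι → n) → K}
    (hf : f ∈ matchSpan w S)
    {i : ι → n} {a : n} (hi : Odd (S.filter fun s => i s = a).card) : f i = 0 := by
  induction hf using Submodule.span_induction with
  | mem f hf =>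
    obtain ⟨M, hM, rfl⟩ := hf
    induction hM with
    | empty => simp at hi
    | @insert S M s t hs ht hst h ih =>
      rw [matchTensor_insert w hs h, Pi.mul_apply]
      by_cases hst' : i s = i t
      · rw [ih, mul_zero]
        rw [filter_insert, filter_insert, hst'] at hi
        by_cases hta : i t = a
        · rw [if_pos hta, if_pos hta, card_insert_of_notMem (by simp [hs, hst]),
            card_insert_of_notMem (by simp [ht])] at hi
          simpa [Nat.odd_add_one] using hi
        · rwa [if_neg hta, if_neg hta] at hi
      · rw [pairing, if_neg hst', zero_mul]
  | zero => rfl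
  | add f g _ _ hf hg => rw [Pi.add_apply, hf, hg, add_zero]
  | smul c f _ hf => rw [Pi.smul_apply, hf, smul_zero]

end

open Finset Function SchurWeylD

noncomputable section

variable {K n V : Type*} [Field K] [Fintype n] [DecidableEq n] [AddCommGroup V] [Module K V]

/-! ### Endomorphisms of tensor powers as tensors -/

/-- The basis of `V^{⊗d}` given by a basis of `V`. -/
abbrev tensorBasis (u : Module.Basis n K V) (d : ℕ) :
    Module.Basis (Fin d → n) K (⨂[K] _ : Fin d, V) :=
  Basis.piTensorProduct fun _ => u

/-- Endomorphisms of `V^{⊗d}` correspond to tensors with `d + d` slots, by lowering the upper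
indices of the matrix with the weights `w`. -/
def toTensor (u : Module.Basis n K V) {w : n → K} (hw : ∀ a, w a ≠ 0) (d : ℕ) :
    Module.End K (⨂[K] _ : Fin d, V) ≃ₗ[K] ((Fin d ⊕ Fin d → n) → K) :=
  LinearMap.toMatrix (tensorBasis u d) (tensorBasis u d) ≪≫ₗ
    { toFun M i := (∏ t, w (i (Sum.inr t))) * M (i ∘ Sum.inr) (i ∘ Sum.inl)
      map_add' M N := by funext i; simp [mul_add]
      map_smul' c M := by funext i; simp; ring
      invFun f J I := (∏ t, w (J t))⁻¹ * f (Sum.elim I J)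
      left_inv M := by
        ext J I
        have : ∏ t, w (J t) ≠ 0 := prod_ne_zero_iff.2 fun t _ => hw _
        simp [this]
      right_inv f := by
        funext i
        have : ∏ t, w (i (Sum.inr t)) ≠ 0 := prod_ne_zero_iff.2 fun t _ => hw _
        simp [this] }

theorem toTensor_apply (u : Module.Basis n K V) {w : n → K} (hw : ∀ a, w a ≠ 0) (d : ℕ)
    (φ : Module.End K (⨂[K] _ : Fin d, V)) (i : Fin d ⊕ Fin d → n) :
    toTensor u hw d φ i = (∏ t, w (i (Sum.inr t))) *
      (tensorBasis u d).repr (φ (⨂ₜ[K] t, u (i (Sum.inl t)))) (i ∘ Sum.inr) := by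
  change (∏ t, w (i (Sum.inr t))) * LinearMap.toMatrix _ _ φ _ _ = _
  rw [LinearMap.toMatrix_apply, Basis.piTensorProduct_apply]
  rfl

/-- The infinitesimal rotation `u_b ↦ w_b u_a`, `u_a ↦ -w_a u_b`. -/
def rotEnd (u : Module.Basis n K V) (w : n → K) (a b : n) : Module.End K V :=
  (w b • u.coord b).smulRight (u a) - (w a • u.coord a).smulRight (u b)

theorem rotEnd_apply (u : Module.Basis n K V) (w : n → K) (a b : n) (v : V) :
    rotEnd u w a b v = (w b * u.repr v b) • u a - (w a * u.repr v a) • u b := rfl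

theorem leibniz_tprod (d : ℕ) (A : Module.End K V) (v : Fin d → V) :
    leibniz d A (PiTensorProduct.tprod K v) =
      ∑ t, PiTensorProduct.tprod K (update v t (A (v t))) := by
  change (∑ t : Fin d, PiTensorProduct.map (update (fun _ => LinearMap.id) t A)) _ = _
  rw [LinearMap.sum_apply]
  refine sum_congr rfl fun t _ => ?_
  rw [PiTensorProduct.map_tprod]
  congr 1
  funext s
  by_cases hs : s = t
  · subst hs; simp
  · simp [hs]

theorem toTensor_mul_leibniz (u : Module.Basis n K V) {w : n → K} (hw : ∀ a, w a ≠ 0) (d : ℕ)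
    (a b : n) (φ : Module.End K (⨂[K] _ : Fin d, V)) (i : Fin d ⊕ Fin d → n) :
    toTensor u hw d (φ * leibniz d (rotEnd u w a b)) i =
      ∑ t : Fin d, ((if i (Sum.inl t) = b then
          w b • toTensor u hw d φ (update i (Sum.inl t) a) else 0) -
        (if i (Sum.inl t) = a then w a • toTensor u hw d φ (update i (Sum.inl t) b) else 0)) := by
  rw [toTensor_apply, Module.End.mul_apply, leibniz_tprod, map_sum, map_sum, Finsupp.finsetSum_apply,
    mul_sum]
  refine sum_congr rfl fun t _ => ?_
  have h1 : ∀ c, toTensor u hw d φ (update i (Sum.inl t) c) = (∏ t, w (i (Sum.inr t))) *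
      (tensorBasis u d).repr (φ (PiTensorProduct.tprod K
        (update (fun t => u (i (Sum.inl t))) t (u c)))) (i ∘ Sum.inr) := by
    intro c
    rw [toTensor_apply]
    have e1 : update i (Sum.inl t) c ∘ Sum.inr = i ∘ Sum.inr := by
      funext s; simp
    have e2 : (fun s => u (update i (Sum.inl t) c (Sum.inl s))) =
        update (fun t => u (i (Sum.inl t))) t (u c) := by
      funext s
      by_cases hs : s = t
      · subst hs; simp
      · simp [hs]
    rw [e1, e2]
    simp
  rw [h1, h1, rotEnd_apply, MultilinearMap.map_update_sub, MultilinearMap.map_update_smul,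
    MultilinearMap.map_update_smul, Module.Basis.repr_self]
  simp only [map_sub, map_smul, Finsupp.sub_apply, Finsupp.smul_apply, smul_eq_mul,
    Finsupp.single_apply]
  split_ifs <;> ring

theorem repr_leibniz (u : Module.Basis n K V) (w : n → K) (d : ℕ) (a b : n)
    (y : ⨂[K] _ : Fin d, V) (J : Fin d → n) :
    (∏ t, w (J t)) * (tensorBasis u d).repr (leibniz d (rotEnd u w a b) y) J =
      ∑ t : Fin d, ((if J t = a then w a * ((∏ s, w (update J t b s)) *
          (tensorBasis u d).repr y (update J t b)) else 0) -
        (if J t = b then w b * ((∏ s, w (update J t a s)) *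
          (tensorBasis u d).repr y (update J t a)) else 0)) := by
  induction y using PiTensorProduct.induction_on with
  | smul_tprod r v =>
    simp only [map_smul, Finsupp.smul_apply, smul_eq_mul, leibniz_tprod, map_sum,
      Finsupp.finsetSum_apply, Basis.piTensorProduct_repr_tprod_apply, mul_sum]
    refine sum_congr rfl fun t _ => ?_
    have h1 : ∀ (v' : Fin d → V) (J' : Fin d → n), (∏ s, w (J' s)) *
        (r * ∏ s, u.repr (v' s) (J' s)) = r * ((w (J' t) * u.repr (v' t) (J' t)) *
          ∏ s ∈ univ.erase t, w (J' s) * u.repr (v' s) (J' s)) := by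
      intro v' J'
      rw [mul_left_comm, mul_prod_erase univ (fun s => w (J' s) * u.repr (v' s) (J' s)) (mem_univ t),
        prod_mul_distrib]
    have h2 : ∀ x, (∏ s ∈ univ.erase t, w (J s) * u.repr (update v t x s) (J s)) =
        ∏ s ∈ univ.erase t, w (J s) * u.repr (v s) (J s) := fun x =>
      prod_congr rfl fun s hs => by rw [update_of_ne (ne_of_mem_erase hs)]
    have h3 : ∀ c, (∏ s ∈ univ.erase t, w (update J t c s) * u.repr (v s) (update J t c s)) =
        ∏ s ∈ univ.erase t, w (J s) * u.repr (v s) (J s) := fun c =>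
      prod_congr rfl fun s hs => by rw [update_of_ne (ne_of_mem_erase hs)]
    rw [h1, h1, h1, h2, h3, h3]
    simp only [update_self, rotEnd_apply, map_sub, map_smul, Module.Basis.repr_self,
      Finsupp.sub_apply, Finsupp.smul_apply, smul_eq_mul, Finsupp.single_apply]
    generalize ∏ s ∈ univ.erase t, w (J s) * u.repr (v s) (J s) = P
    simp only [eq_comm (a := a) (b := J t), eq_comm (a := b) (b := J t)]
    split_ifs with ha hb hb
    · rw [← ha, ← hb]; ring
    · rw [← ha]; ring
    · rw [← hb]; ring
    · ring
  | add x y hx hy =>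
    simp only [map_add, Finsupp.add_apply, mul_add, hx, hy, ← sum_add_distrib]
    refine sum_congr rfl fun t _ => ?_
    split_ifs <;> ring

/-- After lowering, an output slot sees the adjoint of the rotation for the form, which is its
negative. This sign turns the commutator into one sum over all `d + d` slots. -/
theorem toTensor_leibniz_mul (u : Module.Basis n K V) {w : n → K} (hw : ∀ a, w a ≠ 0) (d : ℕ)
    (a b : n) (φ : Module.End K (⨂[K] _ : Fin d, V)) (i : Fin d ⊕ Fin d → n) :
    toTensor u hw d (leibniz d (rotEnd u w a b) * φ) i =
      -∑ t : Fin d, ((if i (Sum.inr t) = b then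
          w b • toTensor u hw d φ (update i (Sum.inr t) a) else 0) -
        (if i (Sum.inr t) = a then w a • toTensor u hw d φ (update i (Sum.inr t) b) else 0)) := by
  have h1 : ∀ t c, toTensor u hw d φ (update i (Sum.inr t) c) =
      (∏ s, w (update (i ∘ Sum.inr) t c s)) *
      (tensorBasis u d).repr (φ (⨂ₜ[K] t, u (i (Sum.inl t)))) (update (i ∘ Sum.inr) t c) := by
    intro t c
    rw [toTensor_apply]
    have e1 : update i (Sum.inr t) c ∘ Sum.inr = update (i ∘ Sum.inr) t c := by
      funext s
      by_cases hs : s = t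
      · subst hs; simp
      · simp [hs]
    rw [← e1]
    simp
  have h2 := repr_leibniz u w d a b (φ (⨂ₜ[K] t, u (i (Sum.inl t)))) (i ∘ Sum.inr)
  rw [toTensor_apply, Module.End.mul_apply]
  simp only [h1]
  refine h2.trans ?_
  rw [← sum_neg_distrib]
  refine sum_congr rfl fun t _ => ?_
  rw [neg_sub]
  rfl

/-- An endomorphism commutes with a rotation iff the corresponding tensor is killed by it. -/
theorem commute_leibniz_rotEnd_iff (u : Module.Basis n K V) {w : n → K} (hw : ∀ a, w a ≠ 0)
    (d : ℕ) (a b : n) (φ : Module.End K (⨂[K] _ : Fin d, V)) :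
    Commute φ (leibniz d (rotEnd u w a b)) ↔ ∀ i, rot w univ a b (toTensor u hw d φ) i = 0 := by
  rw [commute_iff_eq, ← sub_eq_zero, ← (toTensor u hw d).map_eq_zero_iff, funext_iff]
  refine forall_congr' fun i => ?_
  rw [map_sub, Pi.sub_apply, toTensor_mul_leibniz, toTensor_leibniz_mul, sub_neg_eq_add, rot,
    Fintype.sum_sum_type]
  rfl

theorem diagonal_tprod (d : ℕ) (g : Module.End K V) (v : Fin d → V) :
    diagonal d g (PiTensorProduct.tprod K v) = PiTensorProduct.tprod K fun t => g (v t) :=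
  PiTensorProduct.map_tprod _ _

/-- An endomorphism commutes with a diagonal involution iff the corresponding tensor is invariant
under it. -/
theorem commute_diagonal_iff (u : Module.Basis n K V) {w : n → K} (hw : ∀ a, w a ≠ 0) (d : ℕ)
    {g : Module.End K V} {ε : n → K} (hg : ∀ a, g (u a) = ε a • u a) (hε : ∀ a, ε a * ε a = 1)
    (φ : Module.End K (⨂[K] _ : Fin d, V)) :
    Commute φ (diagonal d g) ↔
      ∀ i, (∏ s, ε (i s)) * toTensor u hw d φ i = toTensor u hw d φ i := by
  have hdiag : ∀ I : Fin d → n, diagonal d g (tensorBasis u d I) =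
      (∏ t, ε (I t)) • tensorBasis u d I := by
    intro I
    rw [Basis.piTensorProduct_apply, diagonal_tprod]
    simp only [hg]
    rw [MultilinearMap.map_smul_univ]
  have h1 : ∀ i, toTensor u hw d (φ * diagonal d g) i =
      (∏ t, ε (i (Sum.inl t))) * toTensor u hw d φ i := by
    intro i
    have := hdiag (i ∘ Sum.inl)
    rw [Basis.piTensorProduct_apply] at this
    simp only [comp_apply] at this
    rw [toTensor_apply, toTensor_apply, Module.End.mul_apply, this, map_smul, map_smul,
      Finsupp.smul_apply, smul_eq_mul]
    ring
  have h2 : ∀ (y : ⨂[K] _ : Fin d, V) (J : Fin d → n),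
      (tensorBasis u d).repr (diagonal d g y) J =
        (∏ t, ε (J t)) * (tensorBasis u d).repr y J := by
    intro y J
    suffices h : (tensorBasis u d).coord J ∘ₗ diagonal d g =
        (∏ t, ε (J t)) • (tensorBasis u d).coord J from LinearMap.congr_fun h y
    refine (tensorBasis u d).ext fun I => ?_
    rw [LinearMap.comp_apply, hdiag, map_smul, LinearMap.smul_apply, Module.Basis.coord_apply,
      Module.Basis.repr_self, Finsupp.single_apply]
    split_ifs with h
    · rw [h]
    · simp
  have h3 : ∀ i, toTensor u hw d (diagonal d g * φ) i =
      (∏ t, ε (i (Sum.inr t))) * toTensor u hw d φ i := by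
    intro i
    rw [toTensor_apply, toTensor_apply, Module.End.mul_apply, h2]
    simp only [comp_apply]
    ring
  rw [commute_iff_eq, ← (toTensor u hw d).injective.eq_iff, funext_iff]
  refine forall_congr' fun i => ?_
  rw [h1, h3, Fintype.prod_sum_type]
  -- The signs of the output slots are their own inverse, so they can be moved to the side of the
  -- input slots.
  have h4 : (∏ t, ε (i (Sum.inr t))) * (∏ t, ε (i (Sum.inr t))) = 1 := by
    rw [← prod_mul_distrib]
    exact prod_eq_one fun t _ => hε _
  constructor
  · intro h
    linear_combination (∏ t, ε (i (Sum.inr t))) * h + toTensor u hw d φ i * h4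
  · intro h
    linear_combination (∏ t, ε (i (Sum.inr t))) * h -
      (∏ t, ε (i (Sum.inl t))) * toTensor u hw d φ i * h4

/-- An endomorphism that is skew for the form with weights `w` is a combination of rotations. -/
theorem eq_sum_rotEnd [CharZero K] (u : Module.Basis n K V) {w : n → K} (hw : ∀ a, w a ≠ 0)
    {A : Module.End K V}
    (hA : ∀ a b, w a * u.repr (A (u b)) a = -(w b * u.repr (A (u a)) b)) :
    A = ∑ a, ∑ b, (2⁻¹ * (w b)⁻¹ * u.repr (A (u b)) a) • rotEnd u w a b := by
  -- Each plane occurs twice in the double sum, as `(a, b)` and `(b, a)`, with equal contributions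
  -- by skewness; hence the factor `2⁻¹`.
  refine u.ext fun c => u.ext_elem fun e => ?_
  simp only [LinearMap.sum_apply, LinearMap.smul_apply, rotEnd_apply, Module.Basis.repr_self,
    Finsupp.single_apply, map_sum, map_smul, map_sub, Finsupp.finsetSum_apply,
    Finsupp.smul_apply, Finsupp.sub_apply, smul_eq_mul, mul_sub, sum_sub_distrib, mul_ite, mul_one,
    mul_zero, sum_ite_irrel, sum_const_zero]
  simp only [sum_ite_eq, sum_ite_eq', mem_univ, if_true]
  have h := hA c e
  have hc := hw c
  have he := hw e
  field_simp
  linear_combination h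

end

open Finset Function SchurWeylD Matrix

noncomputable section

/-! ### The algebras acting on the tensor powers -/

section Algebras

attribute [local instance 100] LieRing.ofAssociativeRing in
theorem lift_mem_of_forall_mem {K L A : Type*} [CommRing K] [LieRing L] [LieAlgebra K L] [Ring A]
    [Algebra K A] (f : L →ₗ⁅K⁆ A) (C : Subalgebra K A) (hf : ∀ x, f x ∈ C)
    (a : UniversalEnvelopingAlgebra K L) : UniversalEnvelopingAlgebra.lift K f a ∈ C := by
  let g : L →ₗ⁅K⁆ C :=
    { toFun x := ⟨f x, hf x⟩
      map_add' x y := Subtype.ext (map_add f x y)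
      map_smul' c x := Subtype.ext (map_smul f c x)
      map_lie' {x y} := Subtype.ext (LieHom.map_lie f x y) }
  have key : UniversalEnvelopingAlgebra.lift K f =
      C.val.comp (UniversalEnvelopingAlgebra.lift K g) := by
    apply UniversalEnvelopingAlgebra.hom_ext K
    ext1 x
    change UniversalEnvelopingAlgebra.lift K f (UniversalEnvelopingAlgebra.ι K x) =
      (UniversalEnvelopingAlgebra.lift K g (UniversalEnvelopingAlgebra.ι K x) : C)
    rw [UniversalEnvelopingAlgebra.lift_ι_apply, UniversalEnvelopingAlgebra.lift_ι_apply]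
    rfl
  rw [key]
  exact (UniversalEnvelopingAlgebra.lift K g a).2

variable (K : Type*) [Field K] (m d : ℕ)

theorem mem_EndAlg_rho_iff (φ : Module.End K (TPow K m d)) :
    φ ∈ EndAlg (rho K m d) ↔ ∀ X : So K m, Commute φ (leibniz d (vecLie K m X)) := by
  constructor
  · intro h X
    have := h (UniversalEnvelopingAlgebra.ι K X)
    rw [rho_ι] at this
    exact LinearMap.ext this
  · intro h a
    -- The centraliser of `φ` is a subalgebra, so containing the image of the Lie algebra is enough.
    have h2 : rho K m d a ∈ Subalgebra.centralizer K {φ} :=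
      lift_mem_of_forall_mem (A := Module.End K (TPow K m d)) _ (Subalgebra.centralizer K {φ})
        (fun X => (Subalgebra.mem_centralizer_iff K).2 (by rintro _ rfl; exact h X)) a
    exact fun v => LinearMap.congr_fun ((Subalgebra.mem_centralizer_iff K).1 h2 φ rfl) v

theorem mem_EndAlg_rhoTilde_iff (φ : Module.End K (TPow K m d)) :
    φ ∈ EndAlg (rhoTilde K m d) ↔
      φ ∈ EndAlg (rho K m d) ∧ Commute φ (diagonal d (tauVec K m)) := by
  have hs : ∀ (z : C2) (x : U K m), rhoTilde K m d (SkewMonoidAlgebra.single z x) =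
      rho K m d x * involutionHom (diagonal d (tauVec K m))
        (diagonal_mul_self d (tauVec_mul_tauVec K m)) z := fun z x =>
    SkewMonoidAlgebra.liftNC_single _ _ z x
  constructor
  · intro h
    refine ⟨fun a v => ?_, LinearMap.ext fun v => ?_⟩
    · have := h (SkewMonoidAlgebra.single 1 a) v
      rwa [hs, map_one, mul_one] at this
    · have := h (SkewMonoidAlgebra.single (Multiplicative.ofAdd 1) 1) v
      have h1 : involutionHom (diagonal d (tauVec K m))
        (diagonal_mul_self d (tauVec_mul_tauVec K m)) (Multiplicative.ofAdd 1) =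
          diagonal d (tauVec K m) := by
        change diagonal d (tauVec K m) ^ 1 = _
        rw [pow_one]
      rwa [hs, map_one, one_mul, h1] at this
  · rintro ⟨h1, h2⟩ a
    suffices h : Commute φ (rhoTilde K m d a) from LinearMap.congr_fun h
    induction a using SkewMonoidAlgebra.induction_on with
    | zero => rw [map_zero]; exact Commute.zero_right _
    | single z x =>
      rw [hs]
      have h3 : Commute φ (rho K m d x) := LinearMap.ext (h1 x)
      exact h3.mul_right (h2.pow_right _)
    | add a b ha hb => rw [map_add]; exact ha.add_right hb

end Algebras

/-! ### An orthogonal basis of the vector representation -/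

section Basis

variable (K : Type*) [Field K] (m : ℕ)

/-- The norms of the orthogonal basis `e_j + e_{-j}`, `e_j - e_{-j}` (up to a factor `2`). -/
def weight : Fin m ⊕ Fin m → K := Sum.elim (fun _ => 1) (fun _ => -1)

theorem weight_ne_zero (a : Fin m ⊕ Fin m) : weight K m a ≠ 0 := by
  cases a <;> simp [weight]

/-- The matrix with columns `e_j + e_{-j}` and `e_j - e_{-j}`. -/
def hypMatrix : Matrix (Fin m ⊕ Fin m) (Fin m ⊕ Fin m) K := fromBlocks 1 1 1 (-1)

theorem transpose_hypMatrix : (hypMatrix K m)ᵀ = hypMatrix K m := by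
  simp [hypMatrix, fromBlocks_transpose]

theorem hypMatrix_mul_self : hypMatrix K m * hypMatrix K m = (2 : K) • 1 := by
  rw [hypMatrix, fromBlocks_multiply, ← fromBlocks_one, fromBlocks_smul]
  simp [two_smul]

theorem JD_mul_hypMatrix : LieAlgebra.Orthogonal.JD (Fin m) K * hypMatrix K m =
    hypMatrix K m * Matrix.diagonal (weight K m) := by
  have : Matrix.diagonal (weight K m) = fromBlocks 1 0 0 (-1) := by
    ext (i | i) (j | j) <;> simp [weight, Matrix.diagonal_apply, Matrix.one_apply]
    split_ifs <;> simp
  rw [this, hypMatrix, LieAlgebra.Orthogonal.JD, fromBlocks_multiply, fromBlocks_multiply]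
  simp

theorem hypMatrix_mul_JD : hypMatrix K m * LieAlgebra.Orthogonal.JD (Fin m) K =
    Matrix.diagonal (weight K m) * hypMatrix K m := by
  have h := congrArg Matrix.transpose (JD_mul_hypMatrix K m)
  have hJ : (LieAlgebra.Orthogonal.JD (Fin m) K)ᵀ = LieAlgebra.Orthogonal.JD (Fin m) K := by
    simp [LieAlgebra.Orthogonal.JD, fromBlocks_transpose]
  simpa [transpose_mul, transpose_hypMatrix, hJ] using h

variable [CharZero K]

/-- The basis of `V` consisting of the vectors `e_j + e_{-j}` and `e_j - e_{-j}`. -/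
def hypBasis : Module.Basis (Fin m ⊕ Fin m) K (Vec K m) :=
  Module.Basis.ofEquivFun (LinearEquiv.ofLinearMap
    ((2⁻¹ : K) • Matrix.toLin' (hypMatrix K m)) (Matrix.toLin' (hypMatrix K m))
    (by rw [LinearMap.smul_comp, ← Matrix.toLin'_mul, hypMatrix_mul_self]; simp)
    (by rw [LinearMap.comp_smul, ← Matrix.toLin'_mul, hypMatrix_mul_self]; simp))

theorem hypBasis_repr (v : Vec K m) (a : Fin m ⊕ Fin m) :
    (hypBasis K m).repr v a = 2⁻¹ * (hypMatrix K m *ᵥ v) a := rfl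

theorem hypBasis_apply (a : Fin m ⊕ Fin m) : hypBasis K m a = (hypMatrix K m).col a := by
  rw [hypBasis, Module.Basis.coe_ofEquivFun]
  change Matrix.toLin' (hypMatrix K m) _ = _
  simp

theorem hypBasis_repr_mulVec (X : Matrix (Fin m ⊕ Fin m) (Fin m ⊕ Fin m) K)
    (a b : Fin m ⊕ Fin m) : (hypBasis K m).repr (X *ᵥ hypBasis K m b) a =
      2⁻¹ * (hypMatrix K m * X * hypMatrix K m) a b := by
  rw [hypBasis_repr, hypBasis_apply, mulVec_mulVec, Matrix.mul_apply]
  rfl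

/-- Up to scalars, `P = hypMatrix K m` is its own inverse and transpose and carries the split form
to the diagonal one. The condition becomes skewness of `P X P` for the weights `±1`, with no square
roots needed in `K`. -/
theorem mem_So_iff (X : Matrix (Fin m ⊕ Fin m) (Fin m ⊕ Fin m) K) :
    X ∈ So K m ↔ ∀ a b, weight K m a * (hypMatrix K m * X * hypMatrix K m) a b =
      -(weight K m b * (hypMatrix K m * X * hypMatrix K m) b a) := by
  set P := hypMatrix K m with hP
  set J := LieAlgebra.Orthogonal.JD (Fin m) K with hJ
  set D := Matrix.diagonal (weight K m) with hD
  have hPJ : P * J = D * P := hypMatrix_mul_JD K m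
  have hJP : J * P = P * D := JD_mul_hypMatrix K m
  have hPt : Pᵀ = P := transpose_hypMatrix K m
  have hPP : P * P = (2 : K) • 1 := hypMatrix_mul_self K m
  have h1 : X ∈ So K m ↔ Xᵀ * J = J * (-X) := by
    simp only [So, LieAlgebra.Orthogonal.typeD, mem_skewAdjointMatricesLieSubalgebra,
      mem_skewAdjointMatricesSubmodule, Matrix.IsSkewAdjoint, Matrix.IsAdjointPair]
    exact Iff.rfl
  have h2 : Xᵀ * J = J * (-X) ↔ P * (Xᵀ * J) * P = P * (J * (-X)) * P := by
    refine ⟨fun h => by rw [h], fun h => ?_⟩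
    have h3 := congrArg (fun Y => P * Y * P) h
    simp only [← Matrix.mul_assoc] at h3
    simp only [hPP, Matrix.mul_assoc _ P P, Matrix.mul_smul, Matrix.smul_mul, Matrix.one_mul,
      Matrix.mul_one, Matrix.mul_assoc] at h3
    exact smul_right_injective _ (two_ne_zero' K) (smul_right_injective _ (two_ne_zero' K) h3)
  have h3 : P * (Xᵀ * J) * P = (P * X * P)ᵀ * D := by
    rw [transpose_mul, transpose_mul, hPt]
    simp only [Matrix.mul_assoc, hJP]
  have h4 : P * (J * (-X)) * P = -(D * (P * X * P)) := by
    rw [← Matrix.mul_assoc P J, hPJ]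
    simp [Matrix.mul_assoc]
  rw [h1, h2, h3, h4, ← Matrix.ext_iff]
  constructor
  · intro h a b
    have := h b a
    rw [Matrix.neg_apply, Matrix.mul_diagonal, Matrix.diagonal_mul, transpose_apply] at this
    rw [mul_comm, this]
  · intro h a b
    rw [Matrix.neg_apply, Matrix.mul_diagonal, Matrix.diagonal_mul, transpose_apply, mul_comm,
      h b a]

theorem exists_vecLie_eq_rotEnd (a b : Fin m ⊕ Fin m) :
    ∃ X : So K m, vecLie K m X = rotEnd (hypBasis K m) (weight K m) a b := by
  let Y := LinearMap.toMatrix' (rotEnd (hypBasis K m) (weight K m) a b)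
  have hY : ∀ v, Y *ᵥ v = rotEnd (hypBasis K m) (weight K m) a b v := fun v =>
    LinearMap.congr_fun (Matrix.toLin'_toMatrix' _) v
  refine ⟨⟨Y, (mem_So_iff K m Y).2 fun c e => ?_⟩, LinearMap.ext fun v => ?_⟩
  · have key : ∀ c e, (hypMatrix K m * Y * hypMatrix K m) c e =
        2 * (hypBasis K m).repr (Y *ᵥ hypBasis K m e) c := by
      intro c e
      rw [hypBasis_repr_mulVec, mul_inv_cancel_left₀ two_ne_zero]
    rw [key, key, hY, hY, rotEnd_apply, rotEnd_apply]
    simp only [map_sub, map_smul, Module.Basis.repr_self, Finsupp.sub_apply, Finsupp.smul_apply,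
      Finsupp.single_apply, smul_eq_mul]
    grind
  · rw [vecLie_apply]
    exact hY v

/-- The endomorphisms commuting with the orthogonal Lie algebra correspond to the tensors invariant
under rotations. -/
theorem mem_EndAlg_rho_iff_isRotInv (d : ℕ) (φ : Module.End K (TPow K m d)) :
    φ ∈ EndAlg (rho K m d) ↔ IsRotInv (weight K m) 0 univ
      (toTensor (hypBasis K m) (weight_ne_zero K m) d φ) := by
  rw [mem_EndAlg_rho_iff]
  constructor
  · intro h
    refine ⟨fun i j hij => by rw [funext fun s => hij s (mem_univ s)], fun a b i => ?_⟩
    obtain ⟨X, hX⟩ := exists_vecLie_eq_rotEnd K m a b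
    rw [Pi.zero_apply, Pi.zero_apply, Derivation.zero_apply, add_zero]
    refine (commute_leibniz_rotEnd_iff _ _ _ a b φ).1 ?_ i
    rw [← hX]
    exact h X
  · intro h X
    rw [eq_sum_rotEnd (hypBasis K m) (weight_ne_zero K m) (A := vecLie K m X) fun a b => ?_]
    · simp only [map_sum, map_smul]
      refine Commute.sum_right _ _ _ fun a _ => Commute.sum_right _ _ _ fun b _ =>
        Commute.smul_right ((commute_leibniz_rotEnd_iff _ (weight_ne_zero K m) _ a b φ).2 ?_) _
      intro i
      simpa using h.rot_eq a b i
    · rw [vecLie_apply, vecLie_apply, hypBasis_repr_mulVec, hypBasis_repr_mulVec]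
      linear_combination 2⁻¹ * (mem_So_iff K m X).1 X.2 a b

end Basis

/-! ### Parity for the split form -/

section Parity

variable {K ι : Type*} [Field K] [CharZero K] [DecidableEq ι] {m : ℕ}

/-- Any two basis vectors of opposite norms, not only those with the same index, span a hyperbolic
plane, so on the support of `f` all multiplicities have the same parity. -/
theorem eq_zero_of_even_of_odd {S : Finset ι} {f : (ι → Fin m ⊕ Fin m) → K}
    (hf : IsRotInv (weight K m) 0 S f) {i : ι → Fin m ⊕ Fin m} {z : Fin m ⊕ Fin m}
    (hz : Odd (S.filter fun s => i s = z).card → f i = 0) {a : Fin m ⊕ Fin m}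
    (ha : Odd (S.filter fun s => i s = a).card) : f i = 0 := by
  by_cases hz' : Odd (S.filter fun s => i s = z).card
  · exact hz hz'
  have hpar : ∀ b c, Odd (S.filter fun s => i s = b).card →
      ¬ Odd (S.filter fun s => i s = c).card → weight K m b + weight K m c = 0 → f i = 0 :=
    fun b c hb hc hw => hf.eq_zero_of_odd_add (weight_ne_zero K m b) hw
      (hb.add_even (Nat.not_odd_iff_even.1 hc))
  by_cases hw : weight K m a + weight K m z = 0
  · exact hpar a z ha hz' hw
  -- If `a` and `z` have equal norms, compare both with a vector of the opposite norm.
  obtain ⟨c, hac, hcz⟩ : ∃ c, weight K m a + weight K m c = 0 ∧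
      weight K m c + weight K m z = 0 := by
    rcases a with a | a <;> rcases z with z | z
    · exact ⟨Sum.inr a, by simp [weight], by simp [weight]⟩
    · exact absurd (by simp [weight]) hw
    · exact absurd (by simp [weight]) hw
    · exact ⟨Sum.inl a, by simp [weight], by simp [weight]⟩
  by_cases hc : Odd (S.filter fun s => i s = c).card
  · exact hpar c z hc hz' hcz
  · exact hpar a c ha hc hac

theorem IsRotInv.mem_matchSpan {S : Finset ι} {f : (ι → Fin m ⊕ Fin m) → K}
    (hf : IsRotInv (weight K m) 0 S f)
    (h : ∀ i, ∃ z, Odd (S.filter fun s => i s = z).card → f i = 0) :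
    f ∈ matchSpan (weight K m) S :=
  IsOrthInv.mem_matchSpan
    { inv := hf
      supp := fun i ⟨s, _, hs⟩ => absurd hs (weight_ne_zero K m _)
      even := fun i a ha => by
        obtain ⟨z, hz⟩ := h i
        exact eq_zero_of_even_of_odd hf hz ha }

end Parity

section Main

variable (K : Type*) [Field K] [CharZero K] (m d : ℕ)

theorem mem_EndAlg_rho_iff_mem_matchSpan (hd : d < m) (φ : Module.End K (TPow K m d)) :
    φ ∈ EndAlg (rho K m d) ↔ toTensor (hypBasis K m) (weight_ne_zero K m) d φ ∈
      matchSpan (weight K m) univ := by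
  rw [mem_EndAlg_rho_iff_isRotInv]
  refine ⟨fun h => h.mem_matchSpan fun i => ?_, fun h => matchSpan_le_rotInvSubmodule _ _ h⟩
  -- There are `2d` slots and `2m > 2d` basis vectors; a missing vector occurs zero times, which is
  -- even.
  obtain ⟨z, hz⟩ : ∃ z, z ∉ univ.image i := by
    by_contra! hall
    have h1 := card_le_card (fun z _ => hall z : univ ⊆ univ.image i)
    have h2 := h1.trans card_image_le
    simp only [card_univ, Fintype.card_sum, Fintype.card_fin] at h2
    omega
  refine ⟨z, fun hodd => ?_⟩
  rw [filter_eq_empty_iff.2 fun s _ hs => hz (mem_image.2 ⟨s, mem_univ s, hs⟩)] at hodd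
  simp at hodd

/-- The eigenvalues of the reflection on the orthogonal basis. -/
def reflSign (a : Fin m ⊕ Fin m) : K :=
  Sum.elim (fun _ => 1) (fun j => if j.val + 1 = m then -1 else 1) a

theorem tauVec_hypBasis (a : Fin m ⊕ Fin m) :
    tauVec K m (hypBasis K m a) = reflSign K m a • hypBasis K m a := by
  rw [hypBasis_apply]
  funext i
  change hypMatrix K m (lastSwap m i) a = reflSign K m a * hypMatrix K m i a
  rcases i with i | i <;> rcases a with a | a <;> by_cases hi : i.val + 1 = m <;>
    simp [lastSwap_inl, lastSwap_inr, hi, hypMatrix, reflSign, Matrix.one_apply] <;>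
    grind

theorem prod_reflSign {ι : Type*} [Fintype ι] [DecidableEq ι] (i : ι → Fin m ⊕ Fin m)
    {z : Fin m} (hz : z.val + 1 = m) : ∏ s, reflSign K m (i s) =
      (-1) ^ (univ.filter fun s => i s = Sum.inr z).card := by
  rw [← prod_const, prod_filter]
  refine prod_congr rfl fun s _ => ?_
  rcases i s with a | a
  · simp [reflSign]
  · have : a.val + 1 = m ↔ a = z := by rw [Fin.ext_iff]; omega
    simp [reflSign, this]

/-- In the orthogonal basis `τ` negates only `e_m - e_{-m}`, so commuting with it says that this
vector occurs evenly on the support. Parity propagates this to all basis vectors. -/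
theorem mem_EndAlg_rhoTilde_iff_mem_matchSpan (hm : 1 ≤ m) (φ : Module.End K (TPow K m d)) :
    φ ∈ EndAlg (rhoTilde K m d) ↔ toTensor (hypBasis K m) (weight_ne_zero K m) d φ ∈
      matchSpan (weight K m) univ := by
  obtain ⟨z, hz⟩ : ∃ z : Fin m, z.val + 1 = m := ⟨⟨m - 1, by omega⟩, by simp; omega⟩
  have hsign : ∀ a, reflSign K m a * reflSign K m a = 1 := by
    rintro (a | a)
    · simp [reflSign]
    · simp only [reflSign, Sum.elim_inr]; split_ifs <;> simp
  rw [mem_EndAlg_rhoTilde_iff, mem_EndAlg_rho_iff_isRotInv,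
    commute_diagonal_iff _ (weight_ne_zero K m) d (tauVec_hypBasis K m) hsign]
  simp only [prod_reflSign K m _ hz]
  constructor
  · rintro ⟨h1, h2⟩
    refine h1.mem_matchSpan fun i => ⟨Sum.inr z, fun hodd => ?_⟩
    have := h2 i
    rw [hodd.neg_one_pow] at this
    have h3 : (2 : K) * toTensor (hypBasis K m) (weight_ne_zero K m) d φ i = 0 := by
      linear_combination -this
    simpa using h3
  · intro h
    refine ⟨matchSpan_le_rotInvSubmodule _ _ h, fun i => ?_⟩
    by_cases hodd : Odd (univ.filter fun s => i s = Sum.inr z).card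
    · rw [eq_zero_of_mem_matchSpan_of_odd h hodd, mul_zero]
    · rw [(Nat.not_odd_iff_even.1 hodd).neg_one_pow, one_mul]

/-- The resulting count does not involve `m`, which is what allows the two algebras to be compared.
-/
theorem finrank_eq_of_mem_iff (E : Subalgebra K (Module.End K (TPow K m d))) (hd : d ≤ 2 * m)
    (hE : ∀ φ, φ ∈ E ↔ toTensor (hypBasis K m) (weight_ne_zero K m) d φ ∈
      matchSpan (weight K m) univ) : Module.finrank K E =
        Nat.card {M : Finset (Sym2 (Fin d ⊕ Fin d)) // IsMatching univ M} := by
  rw [← finrank_matchSpan (weight_ne_zero K m) (by simp; omega),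
    ← Subalgebra.finrank_toSubmodule]
  have : Subalgebra.toSubmodule E = (matchSpan (weight K m) univ).map
      (toTensor (hypBasis K m) (weight_ne_zero K m) d).symm.toLinearMap := by
    rw [← Submodule.comap_equiv_eq_map_symm]
    ext φ
    exact hE φ
  rw [this]
  exact LinearEquiv.finrank_map_eq _ _

end Main

end

end OrthInv

theorem mainTheorem8 (K : Type*) [Field K] [CharZero K] (d m m' : ℕ)
    (hd : 1 ≤ d) (hdm : d ≤ 2 * m) (hmm' : 2 * m < m') :
    Module.finrank K (SchurWeylD.EndAlg (SchurWeylD.rhoTilde K m d)) =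
      Module.finrank K (SchurWeylD.EndAlg (SchurWeylD.rho K m' d)) := by
  rw [OrthInv.finrank_eq_of_mem_iff K m d _ hdm
      (OrthInv.mem_EndAlg_rhoTilde_iff_mem_matchSpan K m d (by omega)),
    OrthInv.finrank_eq_of_mem_iff K m' d _ (by omega)
      (OrthInv.mem_EndAlg_rho_iff_mem_matchSpan K m' d (by omega))]
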